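/- Let $\Bbbk$ be a commutative ring, and let $\mathbf{Cat}_{\Bbbk}$ be the $2$-category of small $\Bbbk$-linear categories, $\Bbbk$-linear functors and natural transformations. Let $\mathbf{Cat}_{\Bbbk}^{\oplus}$, $\mathbf{Cat}_{\Bbbk}^{K}$ and $\mathbf{Cat}_{\Bbbk}^{D}$ be its full (on $1$- and $2$-morphisms) sub-$2$-categories whose objects are, respectively, the additive categories (those with all finite direct sums, including a zero object), the idempotent split categories, and the categories which are both additive and idempotent split. A bicategory $\mathcal{C}$ whose hom-categories are small is called bicategorically cocomplete if, for every small bicategory $\mathcal{J}$ and all pseudofunctors $W\colon \mathcal{J}^{\mathrm{op}}\to\mathbf{Cat}$ and $F\colon \mathcal{J}\to\mathcal{C}$, where $\mathbf{Cat}$ is the $2$-category of small categories, there is an object $W\star F$ of $\mathcal{C}$ together with equivalences of categories $$\mathcal{C}(W\star F, i)\;\simeq\;[\mathcal{J}^{\mathrm{op}},\mathbf{Cat}]\bigl(W,\mathcal{C}(F-,i)\bigr)$$ strongly (pseudo-)natural in $i\in\mathcal{C}$. Here $[\mathcal{J}^{\mathrm{op}},\mathbf{Cat}]$ is the bicategory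 of pseudofunctors, strong transformations and modifications. Then: 1. $\mathbf{Cat}_{\Bbbk}^{\oplus}$, $\mathbf{Cat}_{\Bbbk}^{K}$ and $\mathbf{Cat}_{\Bbbk}^{D}$ are bicategorically cocomplete. 2. For every small $\Bbbk$-linear bicategory $\mathcal{B}$ (a small bicategory whose hom-categories are $\Bbbk$-linear and whose horizontal composition is $\Bbbk$-bilinear on $2$-morphisms), the bicategories $[\mathcal{B},\mathbf{Cat}_{\Bbbk}^{\oplus}]_{\Bbbk}$, $[\mathcal{B},\mathbf{Cat}_{\Bbbk}^{K}]_{\Bbbk}$ and $[\mathcal{B},\mathbf{Cat}_{\Bbbk}^{D}]_{\Bbbk}$ of $\Bbbk$-linear pseudofunctors (pseudofunctors which are $\Bbbk$-linear on hom-categories), strong transformations and modifications are bicategorically cocomplete. -/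

import Mathlib

open CategoryTheory Bicategory Opposite Limits
open scoped Pseudofunctor.StrongTrans

universe u v v₁ w₁ u₁ v₂ w₂ u₂ v₃ w₃ u₃

namespace BicatColim

/-! ### Weighted bicategorical colimits -/

section Weighted
variable {A : Type u₁} [Bicategory.{w₁, v₁} A] {B : Type u₂} [Bicategory.{w₂, v₂} B]
  {C : Type u₃} [Bicategory.{w₃, v₃} C]

open Bicategory.Opposite

/-- The pseudofunctor `Fᵒᵖ : Aᵒᵖ ⥤ᵖ Bᵒᵖ` between 1-cell duals induced by `F : A ⥤ᵖ B`. -/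
def opPseudofunctor (F : A ⥤ᵖ B) : Aᵒᵖ ⥤ᵖ Bᵒᵖ where
  obj a := op (F.obj a.unop)
  map f := (F.map f.unop).op
  map₂ η := op2 (F.map₂ η.unop2)
  map₂_id _ := congrArg op2 (F.map₂_id _)
  map₂_comp _ _ := congrArg op2 (F.map₂_comp _ _)
  mapId a := (F.mapId a.unop).op2
  mapComp f g := (F.mapComp g.unop f.unop).op2
  map₂_whisker_left f _ _ η := congrArg op2 (F.map₂_whisker_right _ _)
  map₂_whisker_right η h := congrArg op2 (F.map₂_whisker_left _ _)
  map₂_associator f g h := by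
    have key : F.map₂ (α_ h.unop g.unop f.unop).inv =
        (F.mapComp h.unop (g.unop ≫ f.unop)).hom ≫
          F.map h.unop ◁ (F.mapComp g.unop f.unop).hom ≫
            (α_ (F.map h.unop) (F.map g.unop) (F.map f.unop)).inv ≫
              (F.mapComp h.unop g.unop).inv ▷ F.map f.unop ≫
                (F.mapComp (h.unop ≫ g.unop) f.unop).inv := by
      simp [F.mapComp_assoc_right_hom_assoc]
    exact congrArg op2 key
  map₂_left_unitor f := congrArg op2 (F.map₂_right_unitor _)
  map₂_right_unitor f := congrArg op2 (F.map₂_left_unitor _)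

/-- Whiskering of a strong transformation `η : G ⟶ H` with a pseudofunctor `F`:
the strong transformation `G ∘ F ⟶ H ∘ F`. -/
def whiskerPseudofunctor (F : A ⥤ᵖ B) {G H : B ⥤ᵖ C} (η : G ⟶ H) : F.comp G ⟶ F.comp H where
  app a := η.app (F.obj a)
  naturality f := η.naturality (F.map f)
  naturality_naturality θ := η.naturality_naturality (F.map₂ θ)
  naturality_id a := by
    have h1 := η.naturality_naturality (F.mapId a).hom
    have h2 := η.naturality_id (F.obj a)
    change (η.naturality (F.map (𝟙 a))).hom ≫
      η.app (F.obj a) ◁ (H.map₂ (F.mapId a).hom ≫ (H.mapId (F.obj a)).hom) =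
      (G.map₂ (F.mapId a).hom ≫ (G.mapId (F.obj a)).hom) ▷ η.app (F.obj a) ≫ _
    rw [whiskerLeft_comp, ← Category.assoc, ← h1, Category.assoc, h2, comp_whiskerRight]
    exact (Category.assoc _ _ _).symm
  naturality_comp {a b c} f g := by
    have h1 := η.naturality_naturality (F.mapComp f g).hom
    have h2 := η.naturality_comp (F.map f) (F.map g)
    change (η.naturality (F.map (f ≫ g))).hom ≫
      η.app (F.obj a) ◁ (H.map₂ (F.mapComp f g).hom ≫ (H.mapComp (F.map f) (F.map g)).hom) =
      (G.map₂ (F.mapComp f g).hom ≫ (G.mapComp (F.map f) (F.map g)).hom) ▷ η.app (F.obj c) ≫ _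
    rw [whiskerLeft_comp, ← Category.assoc, ← h1, Category.assoc, h2, comp_whiskerRight]
    exact (Category.assoc _ _ _).symm

/-- Precomposition with `F : A ⥤ᵖ B`, as a pseudofunctor `[B, C] ⥤ᵖ [A, C]`. -/
def precompPseudofunctor (F : A ⥤ᵖ B) : (B ⥤ᵖ C) ⥤ᵖ (A ⥤ᵖ C) where
  obj G := F.comp G
  map η := whiskerPseudofunctor F η
  map₂ Γ := { as := { app a := Γ.as.app (F.obj a), naturality f := Γ.as.naturality (F.map f) } }
  map₂_id η := rfl
  map₂_comp _ _ := rfl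
  mapId G := Pseudofunctor.StrongTrans.isoMk (fun a => Iso.refl (𝟙 (G.obj (F.obj a))))
    (fun {a b} f => by
      change G.map (F.map f) ◁ 𝟙 (𝟙 (G.obj (F.obj b))) ≫ (ρ_ _).hom ≫ (λ_ _).inv =
        ((ρ_ (G.map (F.map f))).hom ≫ (λ_ _).inv) ≫ 𝟙 (𝟙 (G.obj (F.obj a))) ▷ G.map (F.map f)
      simp)
  mapComp {G H K} η θ := Pseudofunctor.StrongTrans.isoMk
    (fun a => Iso.refl (η.app (F.obj a) ≫ θ.app (F.obj a)))
    (fun {a b} f => by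
      change G.map (F.map f) ◁ 𝟙 (η.app (F.obj b) ≫ θ.app (F.obj b)) ≫
          ((η ≫ θ).naturality (F.map f)).hom =
        ((η ≫ θ).naturality (F.map f)).hom ≫
          𝟙 (η.app (F.obj a) ≫ θ.app (F.obj a)) ▷ K.map (F.map f)
      rw [whiskerLeft_id, id_whiskerRight]
      exact (Category.id_comp _).trans (Category.comp_id _).symm)
  map₂_whisker_left f _ _ η := by
    ext a
    exact ((Category.id_comp _).trans (Category.comp_id _)).symm
  map₂_whisker_right η h := by
    ext a
    exact ((Category.id_comp _).trans (Category.comp_id _)).symm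
  map₂_associator {G H K L} f g h := by
    ext a
    change (α_ (f.app (F.obj a)) (g.app (F.obj a)) (h.app (F.obj a))).hom =
      𝟙 _ ≫ 𝟙 _ ▷ _ ≫ (α_ (f.app (F.obj a)) (g.app (F.obj a)) (h.app (F.obj a))).hom ≫
        _ ◁ 𝟙 _ ≫ 𝟙 _
    simp
  map₂_left_unitor f := by
    ext a
    change (λ_ (f.app (F.obj a))).hom = 𝟙 _ ≫ 𝟙 _ ▷ _ ≫ (λ_ (f.app (F.obj a))).hom
    simp
  map₂_right_unitor f := by
    ext a
    change (ρ_ (f.app (F.obj a))).hom = 𝟙 _ ≫ _ ◁ 𝟙 _ ≫ (ρ_ (f.app (F.obj a))).hom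
    simp

/-- The covariant representable pseudofunctor `B(x, -) : B ⥤ᵖ Cat`. -/
def coyoneda₀ (x : B) : B ⥤ᵖ Cat.{w₂, v₂} where
  obj y := Cat.of (x ⟶ y)
  map f := (postcomp x f).toCatHom
  map₂ η := NatTrans.toCatHom₂ ((postcomposing x _ _).map η)
  map₂_id f := by
    ext g
    exact whiskerLeft_id g f
  map₂_comp η θ := by
    ext g
    exact whiskerLeft_comp g η θ
  mapId a := rightUnitorNatIsoCat x a
  mapComp f g := (associatorNatIsoLeftCat x f g).symm
  map₂_whisker_left {a b c} f {g h} η := by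
    ext (t : x ⟶ a)
    change t ◁ f ◁ η = (α_ t f g).inv ≫ (t ≫ f) ◁ η ≫ (α_ t f h).hom
    simp
  map₂_whisker_right {a b c} {f g} η h := by
    ext (t : x ⟶ a)
    change t ◁ η ▷ h = (α_ t f h).inv ≫ (t ◁ η) ▷ h ≫ (α_ t g h).hom
    simp
  map₂_associator {a b c d} f g h := by
    ext (t : x ⟶ a)
    change t ◁ (α_ f g h).hom = (α_ t (f ≫ g) h).inv ≫ (α_ t f g).inv ▷ h ≫ 𝟙 _ ≫
       (α_ (t ≫ f) g h).hom ≫ (α_ t f (g ≫ h)).hom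
    simp
  map₂_left_unitor {a b} f := by
    ext (t : x ⟶ a)
    change t ◁ (λ_ f).hom = (α_ t (𝟙 a) f).inv ≫ (ρ_ t).hom ▷ f ≫ 𝟙 _
    simp
  map₂_right_unitor {a b} f := by
    ext (t : x ⟶ a)
    change t ◁ (ρ_ f).hom = (α_ t f (𝟙 b)).inv ≫ (ρ_ (t ≫ f)).hom ≫ 𝟙 _
    simp

end Weighted

section Colimit

variable {J : Type u} [Bicategory.{u, u} J] {C : Type v} [Bicategory.{u, u} C]

/-- The pseudofunctor `i ↦ [Jᵒᵖ, Cat](W, C(F -, i))` from `C` to `Cat`, as the composite of the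
Yoneda pseudofunctor `C ⥤ᵖ [Cᵒᵖ, Cat]`, precomposition with `Fᵒᵖ`, and `[Jᵒᵖ, Cat](W, -)`. -/
def weightedCocones (W : Jᵒᵖ ⥤ᵖ Cat.{u, u}) (F : J ⥤ᵖ C) : C ⥤ᵖ Cat.{u, u} :=
  ((yoneda (B := C)).comp (precompPseudofunctor (opPseudofunctor F))).comp (coyoneda₀ W)

/-- A weighted bicategorical colimit `W ⋆ F`: an object `pt` of `C` together with equivalences of
categories `C(pt, i) ≌ [Jᵒᵖ, Cat](W, C(F -, i))` strongly natural in `i`. -/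
structure WeightedColimit (W : Jᵒᵖ ⥤ᵖ Cat.{u, u}) (F : J ⥤ᵖ C) where
  pt : C
  rep : coyoneda₀ pt ⟶ weightedCocones W F
  isEquivalence (i : C) : (rep.app i).toFunctor.IsEquivalence

end Colimit

/-- A (locally small) bicategory is bicategorically cocomplete if `W ⋆ F` exists for every small
bicategory `J`, every pseudofunctor `W : Jᵒᵖ ⥤ᵖ Cat` and every pseudofunctor `F : J ⥤ᵖ C`. -/
def BicategoricallyCocomplete (C : Type v) [Bicategory.{u, u} C] : Prop :=
  ∀ (J : Type u) [Bicategory.{u, u} J] (W : Jᵒᵖ ⥤ᵖ Cat.{u, u}) (F : J ⥤ᵖ C),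
    Nonempty (WeightedColimit W F)

/-! ### Linear bicategories and linear pseudofunctors -/

/-- A bicategory whose hom-categories are `k`-linear is a `k`-linear bicategory if horizontal
composition (expressed through the two whiskerings) is `k`-bilinear on 2-morphisms. -/
class LinearBicategory (k : Type u) [CommRing k] (B : Type u₁) [Bicategory.{w₁, v₁} B]
    [∀ a b : B, Preadditive (a ⟶ b)] [∀ a b : B, Linear k (a ⟶ b)] : Prop where
  whiskerLeft_add {a b c : B} (f : a ⟶ b) {g h : b ⟶ c} (η θ : g ⟶ h) :
    f ◁ (η + θ) = f ◁ η + f ◁ θ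
  whiskerLeft_smul {a b c : B} (f : a ⟶ b) {g h : b ⟶ c} (r : k) (η : g ⟶ h) :
    f ◁ (r • η) = r • (f ◁ η)
  add_whiskerRight {a b c : B} {f g : a ⟶ b} (η θ : f ⟶ g) (h : b ⟶ c) :
    (η + θ) ▷ h = η ▷ h + θ ▷ h
  smul_whiskerRight {a b c : B} {f g : a ⟶ b} (r : k) (η : f ⟶ g) (h : b ⟶ c) :
    (r • η) ▷ h = r • (η ▷ h)

/-- A pseudofunctor between `k`-linear bicategories is `k`-linear if each of its local functors
is `k`-linear. -/
structure IsLinearPseudofunctor (k : Type u) [CommRing k]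
    {B : Type u₁} [Bicategory.{w₁, v₁} B]
    [∀ a b : B, Preadditive (a ⟶ b)] [∀ a b : B, Linear k (a ⟶ b)]
    {C : Type u₂} [Bicategory.{w₂, v₂} C]
    [∀ a b : C, Preadditive (a ⟶ b)] [∀ a b : C, Linear k (a ⟶ b)]
    (F : B ⥤ᵖ C) : Prop where
  map₂_add {a b : B} {f g : a ⟶ b} (η θ : f ⟶ g) : F.map₂ (η + θ) = F.map₂ η + F.map₂ θ
  map₂_smul {a b : B} {f g : a ⟶ b} (r : k) (η : f ⟶ g) : F.map₂ (r • η) = r • F.map₂ η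

/-- The full (on 1- and 2-morphisms) sub-bicategory of `C` on the objects satisfying `P`. -/
abbrev FullSubbicategory (C : Type u₁) [Bicategory.{w₁, v₁} C] (P : C → Prop) :=
  InducedBicategory C (Subtype.val : {x : C // P x} → C)

/-- The bicategory `[B, C]_k` of `k`-linear pseudofunctors, strong transformations and
modifications. -/
abbrev LinearPseudofunctorBicategory (k : Type u) [CommRing k]
    (B : Type u₁) [Bicategory.{w₁, v₁} B]
    [∀ a b : B, Preadditive (a ⟶ b)] [∀ a b : B, Linear k (a ⟶ b)]
    (C : Type u₂) [Bicategory.{w₂, v₂} C]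
    [∀ a b : C, Preadditive (a ⟶ b)] [∀ a b : C, Linear k (a ⟶ b)] :=
  FullSubbicategory (B ⥤ᵖ C) (fun F => IsLinearPseudofunctor k F)

/-! A full sub-bicategory of a `k`-linear bicategory inherits the linear structure. -/

namespace FullSubbicategory

variable (k : Type u) [CommRing k] {C : Type u₁} [Bicategory.{w₁, v₁} C] {P : C → Prop}

/-- 2-morphisms of a full sub-bicategory are 2-morphisms of the ambient bicategory. -/
def hom₂Equiv {X Y : FullSubbicategory C P} (f g : X ⟶ Y) : (f ⟶ g) ≃ (f.hom ⟶ g.hom) where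
  toFun η := η.hom
  invFun η := ⟨η⟩

variable [∀ a b : C, Preadditive (a ⟶ b)]

instance preadditive (X Y : FullSubbicategory C P) : Preadditive (X ⟶ Y) where
  homGroup f g := (hom₂Equiv f g).addCommGroup
  add_comp f g h η θ ι := InducedBicategory.hom₂_ext
    (Preadditive.add_comp f.hom g.hom h.hom η.hom θ.hom ι.hom)
  comp_add f g h η θ ι := InducedBicategory.hom₂_ext
    (Preadditive.comp_add f.hom g.hom h.hom η.hom θ.hom ι.hom)

variable [∀ a b : C, Linear k (a ⟶ b)]

instance linear (X Y : FullSubbicategory C P) : Linear k (X ⟶ Y) where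
  homModule f g := (hom₂Equiv f g).module k
  smul_comp f g h r η θ := InducedBicategory.hom₂_ext
    (Linear.smul_comp f.hom g.hom h.hom r η.hom θ.hom)
  comp_smul f g h η r θ := InducedBicategory.hom₂_ext
    (Linear.comp_smul f.hom g.hom h.hom η.hom r θ.hom)

instance linearBicategory [LinearBicategory k C] :
    LinearBicategory k (FullSubbicategory C P) where
  whiskerLeft_add f _ _ η θ := InducedBicategory.hom₂_ext
    (LinearBicategory.whiskerLeft_add k f.hom η.hom θ.hom)
  whiskerLeft_smul f _ _ r η := InducedBicategory.hom₂_ext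
    (LinearBicategory.whiskerLeft_smul f.hom r η.hom)
  add_whiskerRight η θ h := InducedBicategory.hom₂_ext
    (LinearBicategory.add_whiskerRight k η.hom θ.hom h.hom)
  smul_whiskerRight r η h := InducedBicategory.hom₂_ext
    (LinearBicategory.smul_whiskerRight r η.hom h.hom)

end FullSubbicategory

/-! ### The 2-category of small `k`-linear categories -/

/-- A small `k`-linear category. -/
structure LinCat (k : Type u) [CommRing k] where
  carrier : Type u
  [category : Category.{u} carrier]
  [preadditive : Preadditive carrier]
  [linear : Linear k carrier]

namespace LinCat

variable {k : Type u} [CommRing k]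

attribute [instance] category preadditive linear

/-- A `k`-linear functor. -/
structure Hom (C D : LinCat k) where
  functor : C.carrier ⥤ D.carrier
  [additive : functor.Additive]
  [linear : functor.Linear k]

attribute [instance] Hom.additive Hom.linear

/-- A natural transformation between `k`-linear functors. -/
@[ext]
structure Hom₂ {C D : LinCat k} (F G : Hom C D) where
  natTrans : F.functor ⟶ G.functor

instance categoryStruct : CategoryStruct (LinCat k) where
  Hom C D := Hom C D
  id C := { functor := 𝟭 C.carrier }
  comp F G := { functor := F.functor ⋙ G.functor }

instance homCategory (C D : LinCat k) : Category (C ⟶ D) where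
  Hom F G := Hom₂ F G
  id F := ⟨𝟙 F.functor⟩
  comp η θ := ⟨η.natTrans ≫ θ.natTrans⟩
  id_comp η := Hom₂.ext (Category.id_comp η.natTrans)
  comp_id η := Hom₂.ext (Category.comp_id η.natTrans)
  assoc η θ ι := Hom₂.ext (Category.assoc η.natTrans θ.natTrans ι.natTrans)

@[ext]
lemma hom₂_ext {C D : LinCat k} {F G : C ⟶ D} {η θ : F ⟶ G}
    (h : ∀ X, η.natTrans.app X = θ.natTrans.app X) : η = θ :=
  Hom₂.ext (NatTrans.ext (funext h))

/-- A natural isomorphism of `k`-linear functors, as an invertible 2-morphism. -/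
def isoMk {C D : LinCat k} {F G : C ⟶ D} (e : F.functor ≅ G.functor) : F ≅ G where
  hom := ⟨e.hom⟩
  inv := ⟨e.inv⟩
  hom_inv_id := Hom₂.ext e.hom_inv_id
  inv_hom_id := Hom₂.ext e.inv_hom_id

/-- The 2-category `Cat_k` of small `k`-linear categories, `k`-linear functors and natural
transformations. -/
instance bicategory : Bicategory (LinCat k) where
  homCategory C D := homCategory C D
  whiskerLeft F _ _ η := Hom₂.mk (Functor.whiskerLeft F.functor η.natTrans)
  whiskerRight η H := Hom₂.mk (Functor.whiskerRight η.natTrans H.functor)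
  associator F G H := isoMk (F := (F ≫ G) ≫ H) (G := F ≫ G ≫ H)
    (Functor.associator F.functor G.functor H.functor)
  leftUnitor {C _} F := isoMk (F := 𝟙 C ≫ F) (G := F) (Functor.leftUnitor F.functor)
  rightUnitor {_ D} F := isoMk (F := F ≫ 𝟙 D) (G := F) (Functor.rightUnitor F.functor)
  whiskerLeft_id F G := Hom₂.ext (Functor.whiskerLeft_id' F.functor)
  whiskerLeft_comp F _ _ _ η θ := rfl
  id_whiskerLeft η := hom₂_ext fun X => ((Category.id_comp _).trans (Category.comp_id _)).symm
  comp_whiskerLeft F G _ _ η := hom₂_ext fun X => ((Category.id_comp _).trans (Category.comp_id _)).symm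
  id_whiskerRight F G := hom₂_ext fun X => G.functor.map_id _
  comp_whiskerRight η θ H := hom₂_ext fun X => H.functor.map_comp _ _
  whiskerRight_id η := hom₂_ext fun X => ((Category.id_comp _).trans (Category.comp_id _)).symm
  whiskerRight_comp η G H := hom₂_ext fun X => ((Category.id_comp _).trans (Category.comp_id _)).symm
  whisker_assoc F _ _ η H := hom₂_ext fun X => ((Category.id_comp _).trans (Category.comp_id _)).symm
  whisker_exchange η θ := hom₂_ext fun X => (θ.natTrans.naturality (η.natTrans.app X)).symm
  pentagon {_ _ _ _ E} F G H K := hom₂_ext fun X => by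
    change K.functor.map (𝟙 _) ≫ 𝟙 _ ≫ 𝟙 _ = 𝟙 (K.functor.obj _) ≫ 𝟙 _
    simp
  triangle F G := hom₂_ext fun X => by
    change 𝟙 _ ≫ 𝟙 (G.functor.obj _) = G.functor.map (𝟙 _)
    simp

/-- 2-morphisms of `Cat_k` are natural transformations. -/
def hom₂Equiv {C D : LinCat k} (F G : C ⟶ D) : (F ⟶ G) ≃ (F.functor ⟶ G.functor) where
  toFun η := η.natTrans
  invFun η := ⟨η⟩

/-! `Cat_k` is `k`-linear, with pointwise linear combinations of natural transformations. -/

instance homPreadditive (C D : LinCat k) : Preadditive (C ⟶ D) where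
  homGroup F G := (hom₂Equiv F G).addCommGroup
  add_comp F G H η θ ι := Hom₂.ext
    (Preadditive.add_comp F.functor G.functor H.functor η.natTrans θ.natTrans ι.natTrans)
  comp_add F G H η θ ι := Hom₂.ext
    (Preadditive.comp_add F.functor G.functor H.functor η.natTrans θ.natTrans ι.natTrans)

instance homLinear (C D : LinCat k) : Linear k (C ⟶ D) where
  homModule F G := (hom₂Equiv F G).module k
  smul_comp F G H r η θ := Hom₂.ext
    (Linear.smul_comp F.functor G.functor H.functor r η.natTrans θ.natTrans)
  comp_smul F G H η r θ := Hom₂.ext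
    (Linear.comp_smul F.functor G.functor H.functor η.natTrans r θ.natTrans)

instance linearBicategory : LinearBicategory k (LinCat k) where
  whiskerLeft_add _ _ _ _ _ := rfl
  whiskerLeft_smul _ _ _ _ _ := rfl
  add_whiskerRight η θ H := hom₂_ext fun X =>
    H.functor.map_add (f := η.natTrans.app X) (g := θ.natTrans.app X)
  smul_whiskerRight r η H := hom₂_ext fun X => H.functor.map_smul r (η.natTrans.app X)

end LinCat

/-- `Cat_k^⊕`: additive `k`-linear categories, i.e. those with finite direct sums (including the
empty one, a zero object). -/
abbrev AdditiveLinCat (k : Type u) [CommRing k] :=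
  FullSubbicategory (LinCat k) fun C => HasFiniteBiproducts C.carrier

/-- `Cat_k^K`: idempotent split `k`-linear categories. -/
abbrev IdempotentSplitLinCat (k : Type u) [CommRing k] :=
  FullSubbicategory (LinCat k) fun C => IsIdempotentComplete C.carrier

/-- `Cat_k^D`: `k`-linear categories which are both additive and idempotent split. -/
abbrev AdditiveIdempotentSplitLinCat (k : Type u) [CommRing k] :=
  FullSubbicategory (LinCat k) fun C =>
    HasFiniteBiproducts C.carrier ∧ IsIdempotentComplete C.carrier

end BicatColim

/-! A strong transformation from `W` to `C(F -, i)` unpacks into a weighted cocone: 1-cells `F j ⟶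
i` indexed by the objects of `W j`, 2-cells indexed by its arrows, and invertible gluing 2-cells
over the 1-cells of `J`, subject to coherence. Hence `W ⋆ F` exists as soon as some cocone `c` is
universal, in the sense that `c.postcomposing i` is an equivalence for every `i`. Strong naturality
in `i` is then supplied by the associators (`toRep`, `IsColim.weightedColimit`).

For `k`-linear categories, the universal cocone is built by generators and relations. Its objects
are triples `(j, w, x)` with `x` in `F j`. Its morphisms are generated under `k`-linear combinations
and composition by the arrows of the `F j`, the arrows of the weights and invertible gluing arrows.
The relations are the axioms of a `k`-linear category and exactly those that make the tautological
cocone a cocone (`isColim_presentedWCocone`).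

This category need not be additive or idempotent split, so it is replaced by its completion `η : P ⟶
L`: matrices, the Karoubi envelope, or the Karoubi envelope of matrices. In each case composition
with `η` is an equivalence onto functors out of `P`, for every target in the class considered. For
one completion step, the reason is that `η` is fully faithful and each identity of `L` is a finite
sum of morphisms factoring through the image of `η`. A functor on `P` therefore extends as soon as
the target contains the corresponding sums or retracts (`isEquivalence_precomp`); the two-step case
follows by composition. The completed cocone is universal inside the full sub-2-category
(`hasWeightedColimits_fullSubbicategory`).

For pseudofunctors on `B`, colimits are computed pointwise. The coprojections at each `b` are
jointly faithful on 2-cells, so every coherence law of the pointwise colimit, of the transformations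
out of it and of their modifications can be checked after whiskering with coprojections, where it is
inherited from the diagram or the given cocone (`pointwiseData`, `isColim_pointwiseCocone`).
Linearity is detected in the same way (`PseudofunctorData.isLinear`). -/

namespace BicatColim

/-! ### Elementary weighted cocones -/

/-- A `W`-weighted cocone under `F` with vertex `i`, unpacked into its 1-cell and 2-cell
components. -/
structure WCocone {J : Type u₁} [Bicategory.{w₁, v₁} J] {C : Type u₂} [Bicategory.{w₂, v₂} C]
    (W : Jᵒᵖ ⥤ᵖ Cat.{w₃, u₃}) (F : J ⥤ᵖ C) (i : C) where
  obj (j : J) (w : W.obj (op j)) : F.obj j ⟶ i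
  map {j : J} {w w' : W.obj (op j)} (φ : w ⟶ w') : obj j w ⟶ obj j w'
  map_id {j : J} (w : W.obj (op j)) : map (𝟙 w) = 𝟙 (obj j w)
  map_comp {j : J} {w w' w'' : W.obj (op j)} (φ : w ⟶ w') (ψ : w' ⟶ w'') :
    map (φ ≫ ψ) = map φ ≫ map ψ
  glue {j j' : J} (g : j ⟶ j') (w : W.obj (op j')) :
    obj j ((W.map g.op).toFunctor.obj w) ≅ F.map g ≫ obj j' w
  glue_naturality {j j' : J} (g : j ⟶ j') {w w' : W.obj (op j')} (φ : w ⟶ w') :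
    map ((W.map g.op).toFunctor.map φ) ≫ (glue g w').hom = (glue g w).hom ≫ F.map g ◁ map φ
  glue_map₂ {j j' : J} {g g' : j ⟶ j'} (θ : g ⟶ g') (w : W.obj (op j')) :
    map ((W.map₂ (Bicategory.Opposite.op2 θ)).toNatTrans.app w) ≫ (glue g' w).hom =
      (glue g w).hom ≫ F.map₂ θ ▷ obj j' w
  glue_id (j : J) (w : W.obj (op j)) :
    (glue (𝟙 j) w).hom ≫ (F.mapId j).hom ▷ obj j w ≫ (λ_ (obj j w)).hom =
      map ((W.mapId (op j)).hom.toNatTrans.app w)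
  glue_comp {j j' j'' : J} (g : j ⟶ j') (h : j' ⟶ j'') (w : W.obj (op j'')) :
    (glue (g ≫ h) w).hom ≫ (F.mapComp g h).hom ▷ obj j'' w ≫ (α_ _ _ _).hom =
      map ((W.mapComp h.op g.op).hom.toNatTrans.app w) ≫
        (glue g ((W.map h.op).toFunctor.obj w)).hom ≫ F.map g ◁ (glue h w).hom

namespace WCocone

section
variable {J : Type u₁} [Bicategory.{w₁, v₁} J] {C : Type u₂} [Bicategory.{w₂, v₂} C]
  {W : Jᵒᵖ ⥤ᵖ Cat.{w₃, u₃}} {F F' : J ⥤ᵖ C} {i : C}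

/-- A morphism of weighted cocones with the same vertex. -/
@[ext]
structure Hom (c d : WCocone W F i) where
  app (j : J) (w : W.obj (op j)) : c.obj j w ⟶ d.obj j w
  naturality {j : J} {w w' : W.obj (op j)} (φ : w ⟶ w') :
    c.map φ ≫ app j w' = app j w ≫ d.map φ
  glue {j j' : J} (g : j ⟶ j') (w : W.obj (op j')) :
    app j _ ≫ (d.glue g w).hom = (c.glue g w).hom ≫ F.map g ◁ app j' w

@[simps]
instance category : Category (WCocone W F i) where
  Hom := Hom
  id c :=
    { app j w := 𝟙 _
      naturality φ := by simp
      glue g w := by simp }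
  comp η θ :=
    { app j w := η.app j w ≫ θ.app j w
      naturality φ := by simp [reassoc_of% η.naturality φ, θ.naturality]
      glue g w := by simp [reassoc_of% η.glue g w, θ.glue] }

@[ext]
lemma hom_ext {c d : WCocone W F i} {η θ : c ⟶ d} (h : ∀ j w, η.app j w = θ.app j w) : η = θ :=
  Hom.ext (funext fun j => funext fun w => h j w)

/-- Isomorphisms of weighted cocones from componentwise isomorphisms. -/
def isoMk {c d : WCocone W F i} (e : ∀ j w, c.obj j w ≅ d.obj j w)
    (naturality : ∀ {j : J} {w w' : W.obj (op j)} (φ : w ⟶ w'),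
      c.map φ ≫ (e j w').hom = (e j w).hom ≫ d.map φ)
    (glue : ∀ {j j' : J} (g : j ⟶ j') (w : W.obj (op j')),
      (e j _).hom ≫ (d.glue g w).hom = (c.glue g w).hom ≫ F.map g ◁ (e j' w).hom) :
    c ≅ d where
  hom := { app := fun j w => (e j w).hom, naturality := naturality, glue := glue }
  inv :=
    { app := fun j w => (e j w).inv
      naturality := fun {j w w'} φ => by
        rw [← cancel_epi (e j w).hom, Iso.hom_inv_id_assoc, ← reassoc_of% naturality φ,
          Iso.hom_inv_id, Category.comp_id]
      glue := fun {j j'} g w => by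
        rw [← cancel_epi (e j _).hom, Iso.hom_inv_id_assoc, reassoc_of% glue g w,
          whiskerLeft_hom_inv, Category.comp_id] }
  hom_inv_id := by ext; simp
  inv_hom_id := by ext; simp

/-- The components of an isomorphism of weighted cocones. -/
def appIso {c d : WCocone W F i} (e : c ≅ d) (j : J) (w : W.obj (op j)) : c.obj j w ≅ d.obj j w where
  hom := e.hom.app j w
  inv := e.inv.app j w
  hom_inv_id := by rw [← category_comp_app, e.hom_inv_id, category_id_app]
  inv_hom_id := by rw [← category_comp_app, e.inv_hom_id, category_id_app]

/-- Composition of a weighted cocone with a 1-cell out of its vertex. -/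
def postcomp {i' : C} (c : WCocone W F i) (f : i ⟶ i') : WCocone W F i' where
  obj j w := c.obj j w ≫ f
  map φ := c.map φ ▷ f
  map_id w := by simp [c.map_id]
  map_comp φ ψ := by simp [c.map_comp]
  glue g w := whiskerRightIso (c.glue g w) f ≪≫ α_ _ _ _
  glue_naturality g w w' φ := by
    have := congr($(c.glue_naturality g φ) ▷ f)
    simp only [comp_whiskerRight, whisker_assoc] at this
    simp [reassoc_of% this]
  glue_map₂ {j j' g g'} θ w := by
    have := congr($(c.glue_map₂ θ w) ▷ f)
    simp only [comp_whiskerRight] at this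
    simp [reassoc_of% this]
  glue_id j w := by
    have := congr($(c.glue_id j w) ▷ f)
    simp only [comp_whiskerRight] at this
    simp [← this]
  glue_comp g h w := by
    have := congr($(c.glue_comp g h w) ▷ f ≫ (α_ _ _ _).hom ≫ _ ◁ (α_ _ _ _).hom)
    simp only [comp_whiskerRight, whisker_assoc, Category.assoc, Iso.inv_hom_id_assoc,
      pentagon] at this
    simp only [Iso.trans_hom, whiskerRightIso_hom, Category.assoc, whiskerLeft_comp]
    rw [← this]
    simp

/-- Composition of a weighted cocone with 1-cells out of its vertex, as a functor. -/
def postcomposing (c : WCocone W F i) (i' : C) : (i ⟶ i') ⥤ WCocone W F i' where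
  obj f := c.postcomp f
  map {f g} η :=
    { app j w := c.obj j w ◁ η
      naturality φ := (whisker_exchange (c.map φ) η).symm
      glue {j j'} h w := by
        change c.obj j _ ◁ η ≫ (c.glue h w).hom ▷ g ≫ (α_ _ _ _).hom =
          ((c.glue h w).hom ▷ f ≫ (α_ _ _ _).hom) ≫ F.map h ◁ c.obj j' w ◁ η
        simp [whisker_exchange_assoc] }
  map_id f := hom_ext fun j w => whiskerLeft_id _ _
  map_comp η θ := hom_ext fun j w => whiskerLeft_comp _ _ _

/-- Composition of weighted cocones with a fixed 1-cell out of the vertex, as a functor. -/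
def postcompFunctor {i' : C} (f : i ⟶ i') : WCocone W F i ⥤ WCocone W F i' where
  obj c := c.postcomp f
  map {c d} η :=
    { app j w := η.app j w ▷ f
      naturality {j w w'} φ := by
        change c.map φ ▷ f ≫ η.app j w' ▷ f = η.app j w ▷ f ≫ d.map φ ▷ f
        simp [← comp_whiskerRight, η.naturality]
      glue {j j'} h w := by
        change η.app j _ ▷ f ≫ (d.glue h w).hom ▷ f ≫ (α_ _ _ _).hom =
          ((c.glue h w).hom ▷ f ≫ (α_ _ _ _).hom) ≫ F.map h ◁ η.app j' w ▷ f
        simp [← comp_whiskerRight_assoc, η.glue] }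
  map_id f := hom_ext fun j w => id_whiskerRight _ _
  map_comp η θ := hom_ext fun j w => comp_whiskerRight _ _ _

/-- Associativity of `postcomp`. -/
def postcompAssoc {i' i'' : C} (c : WCocone W F i) (f : i ⟶ i') (g : i' ⟶ i'') :
    (c.postcomp f).postcomp g ≅ c.postcomp (f ≫ g) :=
  isoMk (fun j w => α_ (c.obj j w) f g) (fun φ => associator_naturality_left _ _ _)
    (fun {j j'} h w => by
      change (α_ (c.obj j _) f g).hom ≫ (c.glue h w).hom ▷ (f ≫ g) ≫ (α_ _ _ _).hom =
        (((c.glue h w).hom ▷ f ≫ (α_ _ _ _).hom) ▷ g ≫ (α_ _ _ _).hom) ≫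
          F.map h ◁ (α_ (c.obj j' w) f g).hom
      simp)

/-- Composition of a weighted cocone under `F'` with a strong transformation `F ⟶ F'`. -/
def precomp (σ : F ⟶ F') (c : WCocone W F' i) : WCocone W F i where
  obj j w := σ.app j ≫ c.obj j w
  map {j _ _} φ := σ.app j ◁ c.map φ
  map_id w := by simp [c.map_id]
  map_comp φ ψ := by simp [c.map_comp]
  -- The constraint of `σ` enters inverted: the gluing cell of `c` ends in `F' g`, which has to be
  -- moved to the other side of `σ`.
  glue {j j'} g w := whiskerLeftIso (σ.app j) (c.glue g w) ≪≫ (α_ _ _ _).symm ≪≫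
    whiskerRightIso (σ.naturality g).symm (c.obj j' w) ≪≫ α_ _ _ _
  glue_naturality {j j'} g w w' φ := by
    have := congr(σ.app j ◁ $(c.glue_naturality g φ))
    simp only [whiskerLeft_comp] at this
    -- The constraint of `σ` and the 2-cell of `c` act on different factors, so they interchange.
    have h2 := congr((α_ _ _ _).inv ≫ $(whisker_exchange (σ.naturality g).inv (c.map φ)) ≫
      (α_ _ _ _).hom)
    simp only [comp_whiskerLeft, Category.assoc, Iso.inv_hom_id_assoc, Iso.inv_hom_id,
      Category.comp_id] at h2
    simp [reassoc_of% this, h2]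
  glue_map₂ {j j' g g'} θ w := by
    have h : σ.app j ◁ F'.map₂ θ ≫ (σ.naturality g').inv =
        (σ.naturality g).inv ≫ F.map₂ θ ▷ σ.app j' := by
      rw [Iso.comp_inv_eq, Category.assoc, σ.naturality_naturality, Iso.inv_hom_id_assoc]
    have h2 := congr((α_ _ _ _).inv ≫ $h ▷ c.obj j' w)
    simp only [comp_whiskerRight, whisker_assoc, Category.assoc, Iso.inv_hom_id_assoc] at h2
    simp [← whiskerLeft_comp_assoc, c.glue_map₂, reassoc_of% h2]
  glue_id j w := by
    have := congr(σ.app j ◁ $(c.glue_id j w))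
    simp only [whiskerLeft_comp] at this
    simp [← this, Pseudofunctor.StrongTrans.naturality_id_inv]
  glue_comp {j j' j''} g h w := by
    have := congr(σ.app j ◁ $(c.glue_comp g h w))
    simp only [whiskerLeft_comp] at this
    have h2 := congr((α_ _ _ _).inv ≫
      $(whisker_exchange (σ.naturality g).inv (c.glue h w).hom) ≫ (α_ _ _ _).hom)
    simp only [comp_whiskerLeft, Category.assoc, Iso.inv_hom_id_assoc, Iso.inv_hom_id,
      Category.comp_id] at h2
    simp [Pseudofunctor.StrongTrans.naturality_comp_inv, ← reassoc_of% h2, ← reassoc_of% this]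

/-- Composition with a fixed strong transformation `F ⟶ F'`, as a functor on weighted cocones. -/
def precompFunctor (σ : F ⟶ F') : WCocone W F' i ⥤ WCocone W F i where
  obj c := c.precomp σ
  map {c d} η :=
    { app j w := σ.app j ◁ η.app j w
      naturality {j w w'} φ := by
        change σ.app j ◁ c.map φ ≫ σ.app j ◁ η.app j w' = σ.app j ◁ η.app j w ≫ σ.app j ◁ d.map φ
        simp [← whiskerLeft_comp, η.naturality]
      glue {j j'} g w := by
        change σ.app j ◁ η.app j _ ≫ σ.app j ◁ (d.glue g w).hom ≫ (α_ _ _ _).inv ≫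
            (σ.naturality g).inv ▷ d.obj j' w ≫ (α_ _ _ _).hom =
          (σ.app j ◁ (c.glue g w).hom ≫ (α_ _ _ _).inv ≫
            (σ.naturality g).inv ▷ c.obj j' w ≫ (α_ _ _ _).hom) ≫ F.map g ◁ σ.app j' ◁ η.app j' w
        have h := congr(σ.app j ◁ $(η.glue g w))
        simp only [whiskerLeft_comp] at h
        have h2 := congr((α_ _ _ _).inv ≫
          $(whisker_exchange (σ.naturality g).inv (η.app j' w)) ≫ (α_ _ _ _).hom)
        simp only [comp_whiskerLeft, Category.assoc, Iso.inv_hom_id_assoc, Iso.inv_hom_id,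
          Category.comp_id] at h2
        simp [reassoc_of% h, h2] }
  map_id f := hom_ext fun j w => whiskerLeft_id _ _
  map_comp η θ := hom_ext fun j w => whiskerLeft_comp _ _ _

/-- The action of a modification on `precomp`. -/
def precompMap {σ τ : F ⟶ F'} (Γ : σ ⟶ τ) (c : WCocone W F' i) : c.precomp σ ⟶ c.precomp τ where
  app j w := Γ.as.app j ▷ c.obj j w
  naturality {j w w'} φ := whisker_exchange (Γ.as.app j) (c.map φ)
  glue {j j'} g w := by
    change Γ.as.app j ▷ c.obj j _ ≫ τ.app j ◁ (c.glue g w).hom ≫ (α_ _ _ _).inv ≫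
        (τ.naturality g).inv ▷ c.obj j' w ≫ (α_ _ _ _).hom =
      (σ.app j ◁ (c.glue g w).hom ≫ (α_ _ _ _).inv ≫
        (σ.naturality g).inv ▷ c.obj j' w ≫ (α_ _ _ _).hom) ≫ F.map g ◁ Γ.as.app j' ▷ c.obj j' w
    have h : Γ.as.app j ▷ F'.map g ≫ (τ.naturality g).inv =
        (σ.naturality g).inv ≫ F.map g ◁ Γ.as.app j' := by
      rw [Iso.comp_inv_eq, Category.assoc, Γ.as.naturality, Iso.inv_hom_id_assoc]
    have h2 := congr((α_ _ _ _).inv ≫ $h ▷ c.obj j' w ≫ (α_ _ _ _).hom)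
    simp only [comp_whiskerRight, whisker_assoc, Category.assoc, Iso.inv_hom_id,
      Category.comp_id] at h2
    simp [← whisker_exchange_assoc, ← h2]

/-- The action of an invertible modification on `precomp`. -/
def precompMapIso {σ τ : F ⟶ F'} (e : σ ≅ τ) (c : WCocone W F' i) : c.precomp σ ≅ c.precomp τ where
  hom := precompMap e.hom c
  inv := precompMap e.inv c
  hom_inv_id := hom_ext fun j w => by
    change e.hom.as.app j ▷ c.obj j w ≫ e.inv.as.app j ▷ c.obj j w = 𝟙 _
    rw [← comp_whiskerRight]
    exact congr(($e.hom_inv_id).as.app j ▷ c.obj j w).trans (id_whiskerRight _ _)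
  inv_hom_id := hom_ext fun j w => by
    change e.inv.as.app j ▷ c.obj j w ≫ e.hom.as.app j ▷ c.obj j w = 𝟙 _
    rw [← comp_whiskerRight]
    exact congr(($e.inv_hom_id).as.app j ▷ c.obj j w).trans (id_whiskerRight _ _)

/-- `precomp` and `postcomp` commute. -/
def precompPostcomp {i' : C} (σ : F ⟶ F') (c : WCocone W F' i) (f : i ⟶ i') :
    (c.precomp σ).postcomp f ≅ (c.postcomp f).precomp σ :=
  isoMk (fun j w => α_ (σ.app j) (c.obj j w) f)
    (fun {j w w'} φ => associator_naturality_middle _ _ _)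
    (fun {j j'} g w => by
      change (α_ (σ.app j) (c.obj j _) f).hom ≫
          σ.app j ◁ ((c.glue g w).hom ▷ f ≫ (α_ _ _ _).hom) ≫ (α_ _ _ _).inv ≫
          (σ.naturality g).inv ▷ (c.obj j' w ≫ f) ≫ (α_ _ _ _).hom =
        ((σ.app j ◁ (c.glue g w).hom ≫ (α_ _ _ _).inv ≫
          (σ.naturality g).inv ▷ c.obj j' w ≫ (α_ _ _ _).hom) ▷ f ≫ (α_ _ _ _).hom) ≫
          F.map g ◁ (α_ (σ.app j') (c.obj j' w) f).hom
      simp)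

/-- Compatibility of `precomp` with composition of strong transformations. -/
def precompComp {F'' : J ⥤ᵖ C} (σ : F ⟶ F') (τ : F' ⟶ F'') (c : WCocone W F'' i) :
    c.precomp (σ ≫ τ) ≅ (c.precomp τ).precomp σ :=
  isoMk (fun j w => α_ (σ.app j) (τ.app j) (c.obj j w))
    (fun {j w w'} φ => associator_naturality_right _ _ _)
    (fun {j j'} g w => by
      change (α_ (σ.app j) (τ.app j) (c.obj j _)).hom ≫
          σ.app j ◁ (τ.app j ◁ (c.glue g w).hom ≫ (α_ _ _ _).inv ≫
            (τ.naturality g).inv ▷ c.obj j' w ≫ (α_ _ _ _).hom) ≫ (α_ _ _ _).inv ≫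
            (σ.naturality g).inv ▷ (τ.app j' ≫ c.obj j' w) ≫ (α_ _ _ _).hom =
        ((σ.app j ≫ τ.app j) ◁ (c.glue g w).hom ≫ (α_ _ _ _).inv ≫
          (((((α_ (σ.app j) (τ.app j) (F''.map g)).hom ≫ σ.app j ◁ (τ.naturality g).inv) ≫
            (α_ (σ.app j) (F'.map g) (τ.app j')).inv) ≫ (σ.naturality g).inv ▷ τ.app j') ≫
            (α_ (F.map g) (σ.app j') (τ.app j')).hom) ▷ c.obj j' w ≫
          (α_ (F.map g) (σ.app j' ≫ τ.app j') (c.obj j' w)).hom) ≫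
          F.map g ◁ (α_ (σ.app j') (τ.app j') (c.obj j' w)).hom
      simp)

/-- A weighted cocone with vertex `pt` is colimiting relative to a class `Q` of objects if it
induces equivalences between the categories of 1-cells out of `pt` and of weighted cocones, for all
target objects in `Q`. -/
def IsColim {pt : C} (c : WCocone W F pt) (Q : C → Prop) : Prop :=
  ∀ i, Q i → (c.postcomposing i).IsEquivalence

end

end WCocone
end BicatColim

namespace BicatColim

/-! ### Comparison with strong transformations -/

/-- The three identities are the components of the associators of `Cat` in `naturality_comp` for a
transformation between `Cat`-valued pseudofunctors. -/
lemma comp_id_comp_id_comp_id {D : Type u₁} [Category.{v₁} D] {x y z t : D} (f : x ⟶ y)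
    (g : y ⟶ z) (h : z ⟶ t) : f ≫ 𝟙 _ ≫ g ≫ 𝟙 _ ≫ h ≫ 𝟙 _ = f ≫ g ≫ h := by
  simp

namespace WCocone

section
variable {J : Type u₁} [Bicategory.{w₁, v₁} J] {C : Type u₂} [Bicategory.{w₂, v₂} C]
  {W : Jᵒᵖ ⥤ᵖ Cat.{w₂, v₂}} {F : J ⥤ᵖ C} {i : C}

/-- The strong transformation `W ⟶ C(F -, i)` corresponding to a weighted cocone. -/
def toStrong (c : WCocone W F i) :
    W ⟶ (opPseudofunctor F).comp ((yoneda (B := C)).obj i) where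
  app a := Functor.toCatHom (C := W.obj a) (D := (F.obj a.unop ⟶ i))
    { obj := fun w => c.obj a.unop w
      map := fun φ => c.map φ
      map_id := fun w => c.map_id w
      map_comp := fun φ ψ => c.map_comp φ ψ }
  naturality {a b} f := Cat.Hom.isoMk (NatIso.ofComponents (fun w => c.glue f.unop w)
    (fun φ => c.glue_naturality f.unop φ))
  naturality_naturality {a b f g} η := by
    ext w
    exact c.glue_map₂ η.unop2 w
  naturality_id a := by
    ext w
    change (c.glue (𝟙 a.unop) w).hom ≫ (F.mapId a.unop).hom ▷ c.obj a.unop w ≫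
      (λ_ (c.obj a.unop w)).hom = c.map ((W.mapId a).hom.toNatTrans.app w) ≫ 𝟙 _ ≫ 𝟙 _
    rw [Category.comp_id, Category.comp_id]
    exact c.glue_id a.unop w
  naturality_comp f g := by
    ext w
    change (c.glue (g.unop ≫ f.unop) w).hom ≫
      (F.mapComp g.unop f.unop).hom ▷ c.obj _ w ≫ (α_ _ _ _).hom =
        c.map ((W.mapComp f g).hom.toNatTrans.app w) ≫ 𝟙 _ ≫
          (c.glue g.unop ((W.map f).toFunctor.obj w)).hom ≫ 𝟙 _ ≫
            F.map g.unop ◁ (c.glue f.unop w).hom ≫ 𝟙 _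
    exact (c.glue_comp g.unop f.unop w).trans (comp_id_comp_id_comp_id _ _ _).symm

/-- The weighted cocone corresponding to a strong transformation `W ⟶ C(F -, i)`. -/
def ofStrong (σ : W ⟶ (opPseudofunctor F).comp ((yoneda (B := C)).obj i)) : WCocone W F i where
  obj j w := (σ.app (op j)).toFunctor.obj w
  map φ := (σ.app _).toFunctor.map φ
  map_id w := (σ.app _).toFunctor.map_id w
  map_comp φ ψ := (σ.app _).toFunctor.map_comp φ ψ
  glue g w := (Cat.Hom.toNatIso (σ.naturality g.op)).app w
  glue_naturality g w w' φ := (σ.naturality g.op).hom.toNatTrans.naturality φ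
  glue_map₂ θ w := congr($(σ.naturality_naturality (Bicategory.Opposite.op2 θ)).toNatTrans.app w)
  glue_id j w := by
    refine Eq.trans congr($(σ.naturality_id (op j)).toNatTrans.app w) ?_
    change (σ.app (op j)).toFunctor.map ((W.mapId (op j)).hom.toNatTrans.app w) ≫ 𝟙 _ ≫ 𝟙 _ = _
    rw [Category.comp_id, Category.comp_id]
  glue_comp {j j' j''} g h w := by
    refine Eq.trans congr($(σ.naturality_comp h.op g.op).toNatTrans.app w) ?_
    change (σ.app (op j)).toFunctor.map ((W.mapComp h.op g.op).hom.toNatTrans.app w) ≫ 𝟙 _ ≫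
      (σ.naturality g.op).hom.toNatTrans.app ((W.map h.op).toFunctor.obj w) ≫ 𝟙 _ ≫
      F.map g ◁ (σ.naturality h.op).hom.toNatTrans.app w ≫ 𝟙 _ = _
    exact comp_id_comp_id_comp_id _ _ _

/-- The functor from weighted cocones to strong transformations. -/
def toStrongFunctor (W : Jᵒᵖ ⥤ᵖ Cat.{w₂, v₂}) (F : J ⥤ᵖ C) (i : C) :
    WCocone W F i ⥤ (W ⟶ (opPseudofunctor F).comp ((yoneda (B := C)).obj i)) where
  obj c := c.toStrong
  map {c d} η :=
    { as :=
      { app a := NatTrans.toCatHom₂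
          { app := fun w => η.app a.unop w
            naturality := fun _ _ φ => η.naturality φ }
        naturality f := by
          ext w
          exact η.glue f.unop w } }
  map_id c := rfl
  map_comp η θ := rfl

lemma strong_hom_ext {σ τ : W ⟶ (opPseudofunctor F).comp ((yoneda (B := C)).obj i)}
    {Γ Γ' : σ ⟶ τ} (h : ∀ (a : Jᵒᵖ) (w : W.obj a),
      (Γ.as.app a).toNatTrans.app w = (Γ'.as.app a).toNatTrans.app w) : Γ = Γ' := by
  ext a
  exact h a _

/-- `toStrong` is compatible with composition with 1-cells out of the vertex. -/
def toStrongPostcomp (c : WCocone W F i) {i' : C} (f : i ⟶ i') :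
    (c.postcomp f).toStrong ≅
      c.toStrong ≫ whiskerPseudofunctor (opPseudofunctor F) ((yoneda (B := C)).map f) :=
  Pseudofunctor.StrongTrans.isoMk
    (fun a => Cat.Hom.isoMk (NatIso.ofComponents (fun w => Iso.refl (c.obj a.unop w ≫ f))
      (fun φ => (Category.comp_id _).trans (Category.id_comp _).symm)))
    (fun {a b} g => by
      ext w
      change 𝟙 (c.obj b.unop _ ≫ f) ≫ 𝟙 _ ≫ (c.glue g.unop w).hom ▷ f ≫ 𝟙 _ ≫
        (α_ (F.map g.unop) (c.obj a.unop w) f).hom ≫ 𝟙 _ =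
        ((c.glue g.unop w).hom ▷ f ≫ (α_ (F.map g.unop) (c.obj a.unop w) f).hom) ≫
          F.map g.unop ◁ 𝟙 (c.obj a.unop w ≫ f)
      simp)

/-- Both sides consist of the same data, and `ofStrong` is a section of `toStrong` up to
definitional equality; this is why identity isomorphisms suffice. -/
instance : (toStrongFunctor W F i).IsEquivalence where
  faithful := ⟨fun h => hom_ext fun j w => congr(($h).as.app (op j) |>.toNatTrans.app w)⟩
  full := ⟨fun Γ =>
    ⟨{  app j w := (Γ.as.app (op j)).toNatTrans.app w
        naturality φ := (Γ.as.app (op _)).toNatTrans.naturality φ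
        glue g w := congr($(Γ.as.naturality g.op).toNatTrans.app w) }, rfl⟩⟩
  essSurj := ⟨fun σ => ⟨ofStrong σ, ⟨Iso.refl σ⟩⟩⟩

end

variable {J : Type u} [Bicategory.{u, u} J] {C : Type v} [Bicategory.{u, u} C]
  {W : Jᵒᵖ ⥤ᵖ Cat.{u, u}} {F : J ⥤ᵖ C}

/-- The strong transformation `C(pt, -) ⟶ [Jᵒᵖ, Cat](W, C(F -, -))` induced by a weighted cocone
with vertex `pt`. -/
def toRep {pt : C} (c : WCocone W F pt) : coyoneda₀ pt ⟶ weightedCocones W F where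
  app i := Functor.toCatHom (C := (pt ⟶ i))
    (D := (W ⟶ (opPseudofunctor F).comp ((yoneda (B := C)).obj i)))
    (c.postcomposing i ⋙ toStrongFunctor W F i)
  naturality {i i'} f := Cat.Hom.isoMk (NatIso.ofComponents
    (fun g => (toStrongFunctor W F i').mapIso (c.postcompAssoc g f).symm ≪≫
      (c.postcomp g).toStrongPostcomp f)
    (fun {g g'} η => strong_hom_ext fun a w => by
      change c.obj a.unop w ◁ η ▷ f ≫ (α_ (c.obj a.unop w) g' f).inv ≫ 𝟙 _ =
        ((α_ (c.obj a.unop w) g f).inv ≫ 𝟙 _) ≫ (c.obj a.unop w ◁ η) ▷ f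
      rw [Category.comp_id, Category.comp_id]
      exact associator_inv_naturality_middle (c.obj a.unop w) η f))
  naturality_naturality {i i' f g} η := Cat.Hom₂.ext (NatTrans.ext (funext fun t =>
    strong_hom_ext fun a w => by
      change c.obj a.unop w ◁ t ◁ η ≫ (α_ (c.obj a.unop w) t g).inv ≫ 𝟙 _ =
        ((α_ (c.obj a.unop w) t f).inv ≫ 𝟙 _) ≫ (c.obj a.unop w ≫ t) ◁ η
      rw [Category.comp_id, Category.comp_id]
      exact associator_inv_naturality_right (c.obj a.unop w) t η))
  naturality_id i := Cat.Hom₂.ext (NatTrans.ext (funext fun t =>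
    strong_hom_ext fun a w => by
      -- The goal has this form only after unfolding; for abstract 1-cells it is plain bicategorical
      -- coherence.
      have key {p q r : C} (x : p ⟶ q) (t : q ⟶ r) :
          ((α_ x t (𝟙 r)).inv ≫ 𝟙 _) ≫ ((ρ_ (x ≫ t)).hom ≫ 𝟙 _) ≫ 𝟙 _ =
            x ◁ (ρ_ t).hom ≫ 𝟙 _ ≫ 𝟙 _ := by simp
      exact key (c.obj a.unop w) t))
  naturality_comp f g := Cat.Hom₂.ext (NatTrans.ext (funext fun t =>
    strong_hom_ext fun a w => by
      have key {p q r s s' : C} (x : p ⟶ q) (t : q ⟶ r) (f : r ⟶ s) (g : s ⟶ s') :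
          ((α_ x t (f ≫ g)).inv ≫ 𝟙 _) ≫ ((α_ (x ≫ t) f g).inv ≫ 𝟙 _) ≫ 𝟙 _ =
            x ◁ (α_ t f g).inv ≫ 𝟙 _ ≫ ((α_ x (t ≫ f) g).inv ≫ 𝟙 _) ≫
              𝟙 _ ≫ (((α_ x t f).inv ≫ 𝟙 _) ▷ g) ≫ 𝟙 _ := by simp
      exact key (c.obj a.unop w) t f g))

/-- A weighted cocone that is colimiting for all target objects is a weighted bicategorical
colimit. -/
def IsColim.weightedColimit {pt : C} {c : WCocone W F pt} (hc : c.IsColim fun _ => True) :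
    WeightedColimit W F where
  pt := pt
  rep := c.toRep
  isEquivalence i := by
    have := hc i trivial
    exact inferInstanceAs (c.postcomposing i ⋙ toStrongFunctor W F i).IsEquivalence

end WCocone
end BicatColim

namespace BicatColim

/-! ### Full sub-bicategories -/

namespace FullSubbicategory

section
variable {J : Type u₁} [Bicategory.{w₁, v₁} J] {C : Type u₂} [Bicategory.{w₂, v₂} C]
  {P : C → Prop}

/-- 2-isomorphisms in a full sub-bicategory, viewed in the ambient bicategory. -/
def homIso {X Y : FullSubbicategory C P} {f g : X ⟶ Y} (e : f ≅ g) : f.hom ≅ g.hom where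
  hom := e.hom.hom
  inv := e.inv.hom
  hom_inv_id := congr(($e.hom_inv_id).hom)
  inv_hom_id := congr(($e.inv_hom_id).hom)

/-- A pseudofunctor into a full sub-bicategory, viewed as a pseudofunctor into the ambient
bicategory. -/
def val (F : J ⥤ᵖ FullSubbicategory C P) : J ⥤ᵖ C where
  obj j := (F.obj j).1
  map f := (F.map f).hom
  map₂ η := (F.map₂ η).hom
  map₂_id f := congr(($(F.map₂_id f)).hom)
  map₂_comp η θ := congr(($(F.map₂_comp η θ)).hom)
  mapId j := homIso (F.mapId j)
  mapComp f g := homIso (F.mapComp f g)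
  map₂_whisker_left f _ _ η := congr(($(F.map₂_whisker_left f η)).hom)
  map₂_whisker_right η h := congr(($(F.map₂_whisker_right η h)).hom)
  map₂_associator f g h := congr(($(F.map₂_associator f g h)).hom)
  map₂_left_unitor f := congr(($(F.map₂_left_unitor f)).hom)
  map₂_right_unitor f := congr(($(F.map₂_right_unitor f)).hom)

variable {W : Jᵒᵖ ⥤ᵖ Cat.{w₃, u₃}} {F : J ⥤ᵖ FullSubbicategory C P}

/-- A weighted cocone in a full sub-bicategory, from one in the ambient bicategory. -/
def liftWCocone (X : FullSubbicategory C P) (c : WCocone W (val F) X.1) : WCocone W F X where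
  obj j w := InducedBicategory.mkHom (c.obj j w)
  map φ := InducedBicategory.Hom₂.mk (c.map φ)
  map_id w := InducedBicategory.hom₂_ext (c.map_id w)
  map_comp φ ψ := InducedBicategory.hom₂_ext (c.map_comp φ ψ)
  glue g w := InducedBicategory.isoMk (c.glue g w)
  glue_naturality g _ _ φ := InducedBicategory.hom₂_ext (c.glue_naturality g φ)
  glue_map₂ θ w := InducedBicategory.hom₂_ext (c.glue_map₂ θ w)
  glue_id j w := InducedBicategory.hom₂_ext (c.glue_id j w)
  glue_comp g h w := InducedBicategory.hom₂_ext (c.glue_comp g h w)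

/-- Weighted cocones in a full sub-bicategory are weighted cocones in the ambient bicategory. -/
def valWCocone (X : FullSubbicategory C P) : WCocone W F X ⥤ WCocone W (val F) X.1 where
  obj c :=
    { obj j w := (c.obj j w).hom
      map φ := (c.map φ).hom
      map_id w := congr(($(c.map_id w)).hom)
      map_comp φ ψ := congr(($(c.map_comp φ ψ)).hom)
      glue g w := homIso (c.glue g w)
      glue_naturality g _ _ φ := congr(($(c.glue_naturality g φ)).hom)
      glue_map₂ θ w := congr(($(c.glue_map₂ θ w)).hom)
      glue_id j w := congr(($(c.glue_id j w)).hom)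
      glue_comp g h w := congr(($(c.glue_comp g h w)).hom) }
  map η :=
    { app j w := (η.app j w).hom
      naturality φ := congr(($(η.naturality φ)).hom)
      glue g w := congr(($(η.glue g w)).hom) }

instance (X : FullSubbicategory C P) : (valWCocone (W := W) (F := F) X).IsEquivalence where
  faithful := ⟨fun h => WCocone.hom_ext fun j w =>
    InducedBicategory.hom₂_ext congr(($h).app j w)⟩
  full := ⟨fun η => ⟨
    { app j w := InducedBicategory.Hom₂.mk (η.app j w)
      naturality φ := InducedBicategory.hom₂_ext (η.naturality φ)
      glue g w := InducedBicategory.hom₂_ext (η.glue g w) }, rfl⟩⟩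
  essSurj := ⟨fun c => ⟨liftWCocone X c, ⟨Iso.refl c⟩⟩⟩

/-- The hom-categories of a full sub-bicategory are those of the ambient bicategory. -/
def homFunctor (X Y : FullSubbicategory C P) : (X ⟶ Y) ⥤ (X.1 ⟶ Y.1) where
  obj f := f.hom
  map η := η.hom

instance (X Y : FullSubbicategory C P) : (homFunctor X Y).IsEquivalence where
  faithful := ⟨fun h => InducedBicategory.hom₂_ext h⟩
  full := ⟨fun η => ⟨InducedBicategory.Hom₂.mk η, rfl⟩⟩
  essSurj := ⟨fun f => ⟨InducedBicategory.mkHom f, ⟨Iso.refl f⟩⟩⟩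

/-- Two-out-of-three: `postcomposing` for the lifted cocone and for `c` form a square, commuting by
definition, with the equivalences `homFunctor` and `valWCocone`. -/
lemma isColim_liftWCocone {X : FullSubbicategory C P} {c : WCocone W (val F) X.1}
    (hc : c.IsColim P) : (liftWCocone X c).IsColim fun _ => True := fun Y _ => by
  have := hc Y.1 Y.2
  have : ((liftWCocone X c).postcomposing Y ⋙ valWCocone Y).IsEquivalence :=
    inferInstanceAs (homFunctor X Y ⋙ c.postcomposing Y.1).IsEquivalence
  exact Functor.isEquivalence_of_comp_right _ (valWCocone Y)

end

end FullSubbicategory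
end BicatColim

namespace BicatColim

/-! ### Weighted colimits of `k`-linear categories, by generators and relations -/

namespace LinCat

namespace Presentation

section
variable {k : Type u} [CommRing k] {J : Type u} [Bicategory.{u, u} J]
  (W : Jᵒᵖ ⥤ᵖ Cat.{u, u}) (F : J ⥤ᵖ LinCat k)

/-- The objects of the weighted colimit. -/
structure Obj where
  idx : J
  weight : W.obj (op idx)
  pt : (F.obj idx).carrier

variable {W F}

/-- Formal expressions for the morphisms of the weighted colimit. -/
inductive Word : Obj W F → Obj W F → Type u
  | idt (X) : Word X X
  | comp {X Y Z} : Word X Y → Word Y Z → Word X Z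
  | zero (X Y) : Word X Y
  | add {X Y} : Word X Y → Word X Y → Word X Y
  | neg {X Y} : Word X Y → Word X Y
  | smul {X Y} : k → Word X Y → Word X Y
  | act {j} (w) {x y : (F.obj j).carrier} (f : x ⟶ y) : Word ⟨j, w, x⟩ ⟨j, w, y⟩
  | tr {j} {w w' : W.obj (op j)} (φ : w ⟶ w') (x) : Word ⟨j, w, x⟩ ⟨j, w', x⟩
  | glue {j j'} (g : j ⟶ j') (w) (x) :
      Word ⟨j, (W.map g.op).toFunctor.obj w, x⟩ ⟨j', w, (F.map g).functor.obj x⟩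
  | glueInv {j j'} (g : j ⟶ j') (w) (x) :
      Word ⟨j', w, (F.map g).functor.obj x⟩ ⟨j, (W.map g.op).toFunctor.obj w, x⟩

open Word

/-- The relations between formal expressions for morphisms. -/
inductive Rel : ∀ {X Y : Obj W F}, Word X Y → Word X Y → Prop
  | refl {X Y} (a : Word X Y) : Rel a a
  | symm {X Y} {a b : Word X Y} : Rel a b → Rel b a
  | trans {X Y} {a b c : Word X Y} : Rel a b → Rel b c → Rel a c
  | comp_congr {X Y Z} {a a' : Word X Y} {b b' : Word Y Z} :
      Rel a a' → Rel b b' → Rel (comp a b) (comp a' b')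
  | add_congr {X Y} {a a' b b' : Word X Y} : Rel a a' → Rel b b' → Rel (add a b) (add a' b')
  | neg_congr {X Y} {a a' : Word X Y} : Rel a a' → Rel (neg a) (neg a')
  | smul_congr {X Y} (r : k) {a a' : Word X Y} : Rel a a' → Rel (smul r a) (smul r a')
  | id_comp {X Y} (a : Word X Y) : Rel (comp (idt X) a) a
  | comp_id {X Y} (a : Word X Y) : Rel (comp a (idt Y)) a
  | assoc {X Y Z T} (a : Word X Y) (b : Word Y Z) (c : Word Z T) :
      Rel (comp (comp a b) c) (comp a (comp b c))
  | add_assoc {X Y} (a b c : Word X Y) : Rel (add (add a b) c) (add a (add b c))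
  | zero_add {X Y} (a : Word X Y) : Rel (add (zero X Y) a) a
  | add_comm {X Y} (a b : Word X Y) : Rel (add a b) (add b a)
  | neg_add {X Y} (a : Word X Y) : Rel (add (neg a) a) (zero X Y)
  | one_smul {X Y} (a : Word X Y) : Rel (smul 1 a) a
  | mul_smul {X Y} (r s : k) (a : Word X Y) : Rel (smul (r * s) a) (smul r (smul s a))
  | smul_add {X Y} (r : k) (a b : Word X Y) : Rel (smul r (add a b)) (add (smul r a) (smul r b))
  | add_smul {X Y} (r s : k) (a : Word X Y) : Rel (smul (r + s) a) (add (smul r a) (smul s a))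
  | add_comp {X Y Z} (a b : Word X Y) (c : Word Y Z) :
      Rel (comp (add a b) c) (add (comp a c) (comp b c))
  | comp_add {X Y Z} (a : Word X Y) (b c : Word Y Z) :
      Rel (comp a (add b c)) (add (comp a b) (comp a c))
  | smul_comp {X Y Z} (r : k) (a : Word X Y) (b : Word Y Z) :
      Rel (comp (smul r a) b) (smul r (comp a b))
  | comp_smul {X Y Z} (r : k) (a : Word X Y) (b : Word Y Z) :
      Rel (comp a (smul r b)) (smul r (comp a b))
  | act_id {j} (w) (x : (F.obj j).carrier) : Rel (act w (𝟙 x)) (idt _)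
  | act_comp {j} (w) {x y z : (F.obj j).carrier} (f : x ⟶ y) (g : y ⟶ z) :
      Rel (act w (f ≫ g)) (comp (act w f) (act w g))
  | act_add {j} (w) {x y : (F.obj j).carrier} (f g : x ⟶ y) :
      Rel (act w (f + g)) (add (act w f) (act w g))
  | act_smul {j} (w) {x y : (F.obj j).carrier} (r : k) (f : x ⟶ y) :
      Rel (act w (r • f)) (smul r (act w f))
  | tr_id {j} (w : W.obj (op j)) (x) : Rel (tr (𝟙 w) x) (idt _)
  | tr_comp {j} {w w' w'' : W.obj (op j)} (φ : w ⟶ w') (ψ : w' ⟶ w'') (x) :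
      Rel (tr (φ ≫ ψ) x) (comp (tr φ x) (tr ψ x))
  | tr_act {j} {w w' : W.obj (op j)} (φ : w ⟶ w') {x y : (F.obj j).carrier} (f : x ⟶ y) :
      Rel (comp (act w f) (tr φ y)) (comp (tr φ x) (act w' f))
  | glue_glueInv {j j'} (g : j ⟶ j') (w) (x) : Rel (comp (glue g w x) (glueInv g w x)) (idt _)
  | glueInv_glue {j j'} (g : j ⟶ j') (w) (x) : Rel (comp (glueInv g w x) (glue g w x)) (idt _)
  | glue_act {j j'} (g : j ⟶ j') (w) {x y : (F.obj j).carrier} (f : x ⟶ y) :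
      Rel (comp (act _ f) (glue g w y)) (comp (glue g w x) (act w ((F.map g).functor.map f)))
  | glue_tr {j j'} (g : j ⟶ j') {w w' : W.obj (op j')} (φ : w ⟶ w') (x) :
      Rel (comp (tr ((W.map g.op).toFunctor.map φ) x) (glue g w' x)) (comp (glue g w x) (tr φ _))
  | glue_map₂ {j j'} {g g' : j ⟶ j'} (θ : g ⟶ g') (w) (x) :
      Rel (comp (tr ((W.map₂ (Bicategory.Opposite.op2 θ)).toNatTrans.app w) x) (glue g' w x))
        (comp (glue g w x) (act w ((F.map₂ θ).natTrans.app x)))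
  | glue_id {j} (w) (x : (F.obj j).carrier) :
      Rel (comp (glue (𝟙 j) w x) (act w ((F.mapId j).hom.natTrans.app x)))
        (tr ((W.mapId (op j)).hom.toNatTrans.app w) x)
  | glue_comp {j j' j''} (g : j ⟶ j') (h : j' ⟶ j'') (w) (x) :
      Rel (comp (glue (g ≫ h) w x) (act w ((F.mapComp g h).hom.natTrans.app x)))
        (comp (tr ((W.mapComp h.op g.op).hom.toNatTrans.app w) x)
          (comp (glue g ((W.map h.op).toFunctor.obj w) x) (glue h w ((F.map g).functor.obj x))))

instance setoid (X Y : Obj W F) : Setoid (Word X Y) where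
  r := Rel
  iseqv := ⟨Rel.refl, Rel.symm, Rel.trans⟩

/-- The morphisms of the weighted colimit. -/
def Mor (X Y : Obj W F) : Type u := Quotient (setoid X Y)

/-- The class of a formal expression. -/
def Mor.mk {X Y : Obj W F} (a : Word X Y) : Mor X Y := Quotient.mk _ a

lemma Mor.sound {X Y : Obj W F} {a b : Word X Y} (h : Rel a b) : Mor.mk a = Mor.mk b :=
  Quotient.sound h

lemma Mor.ind {X Y : Obj W F} {p : Mor X Y → Prop} (h : ∀ a, p (Mor.mk a)) (a : Mor X Y) : p a :=
  Quotient.ind h a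

instance category : Category.{u} (Obj W F) where
  Hom := Mor
  id X := Mor.mk (idt X)
  comp := Quotient.map₂ comp fun _ _ h _ _ h' => Rel.comp_congr h h'
  id_comp := Mor.ind fun a => Mor.sound (Rel.id_comp a)
  comp_id := Mor.ind fun a => Mor.sound (Rel.comp_id a)
  assoc := Mor.ind fun a => Mor.ind fun b => Mor.ind fun c => Mor.sound (Rel.assoc a b c)

/-- The class of a formal expression, as a morphism. -/
def cls {X Y : Obj W F} (a : Word X Y) : X ⟶ Y := Mor.mk a

lemma sound {X Y : Obj W F} {a b : Word X Y} (h : Rel a b) : cls a = cls b := Mor.sound h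

instance hasAdd (X Y : Obj W F) : Add (X ⟶ Y) :=
  ⟨Quotient.map₂ add fun _ _ h _ _ h' => Rel.add_congr h h'⟩

instance hasZero (X Y : Obj W F) : Zero (X ⟶ Y) := ⟨cls (zero X Y)⟩

instance hasNeg (X Y : Obj W F) : Neg (X ⟶ Y) :=
  ⟨Quotient.map neg fun _ _ h => Rel.neg_congr h⟩

instance addCommGroup (X Y : Obj W F) : AddCommGroup (X ⟶ Y) where
  nsmul := nsmulRec
  zsmul := zsmulRec
  add_assoc := Mor.ind fun a => Mor.ind fun b => Mor.ind fun c => sound (Rel.add_assoc a b c)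
  zero_add := Mor.ind fun a => sound (Rel.zero_add a)
  add_zero := Mor.ind fun a => sound ((Rel.add_comm _ _).trans (Rel.zero_add a))
  add_comm := Mor.ind fun a => Mor.ind fun b => sound (Rel.add_comm a b)
  neg_add_cancel := Mor.ind fun a => sound (Rel.neg_add a)

instance smul (X Y : Obj W F) : SMul k (X ⟶ Y) :=
  ⟨fun r => Quotient.map (Word.smul r) fun _ _ h => Rel.smul_congr r h⟩

instance module (X Y : Obj W F) : Module k (X ⟶ Y) :=
  Module.ofMinimalAxioms
    (fun r => Mor.ind fun a => Mor.ind fun b => sound (Rel.smul_add r a b))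
    (fun r s => Mor.ind fun a => sound (Rel.add_smul r s a))
    (fun r s => Mor.ind fun a => sound (Rel.mul_smul r s a))
    (Mor.ind fun a => sound (Rel.one_smul a))

instance preadditive : Preadditive (Obj W F) where
  homGroup := addCommGroup
  add_comp _ _ _ := Mor.ind fun a => Mor.ind fun b => Mor.ind fun c => sound (Rel.add_comp a b c)
  comp_add _ _ _ := Mor.ind fun a => Mor.ind fun b => Mor.ind fun c => sound (Rel.comp_add a b c)

instance linear : Linear k (Obj W F) where
  homModule := module
  smul_comp _ _ _ r := Mor.ind fun a => Mor.ind fun b => sound (Rel.smul_comp r a b)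
  comp_smul _ _ _ := Mor.ind fun a r => Mor.ind fun b => sound (Rel.comp_smul r a b)

/-- Naturality squares are closed under composition and linear combinations, so induction on words
reduces the claim to generators. Inverse gluing arrows need no hypothesis of their own. -/
lemma naturality_of_generators {E : Type u₁} [Category.{v₁} E] [Preadditive E] [Linear k E]
    {f g : Obj W F ⥤ E} [f.Additive] [f.Linear k] [g.Additive] [g.Linear k]
    (τ : ∀ X, f.obj X ⟶ g.obj X)
    (hact : ∀ {j} (w) (x y : (F.obj j).carrier) (h : x ⟶ y),
      f.map (cls (.act w h)) ≫ τ ⟨j, w, y⟩ = τ ⟨j, w, x⟩ ≫ g.map (cls (.act w h)))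
    (htr : ∀ {j} {w w' : W.obj (op j)} (φ : w ⟶ w') (x),
      f.map (cls (.tr φ x)) ≫ τ ⟨j, w', x⟩ = τ ⟨j, w, x⟩ ≫ g.map (cls (.tr φ x)))
    (hglue : ∀ {j j'} (h : j ⟶ j') (w) (x),
      f.map (cls (.glue h w x)) ≫ τ _ = τ _ ≫ g.map (cls (.glue h w x)))
    {X Y : Obj W F} (a : Word X Y) : f.map (cls a) ≫ τ Y = τ X ≫ g.map (cls a) := by
  induction a with
  | idt X =>
    change f.map (𝟙 X) ≫ _ = _ ≫ g.map (𝟙 X)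
    simp
  | comp a b ha hb =>
    change f.map (cls a ≫ cls b) ≫ _ = _ ≫ g.map (cls a ≫ cls b)
    rw [f.map_comp, g.map_comp, Category.assoc, hb, reassoc_of% ha]
  | zero X Y =>
    change f.map 0 ≫ _ = _ ≫ g.map 0
    simp
  | add a b ha hb =>
    change f.map (cls a + cls b) ≫ _ = _ ≫ g.map (cls a + cls b)
    rw [f.map_add, g.map_add, Preadditive.add_comp, Preadditive.comp_add, ha, hb]
  | neg a ha =>
    change f.map (- cls a) ≫ _ = _ ≫ g.map (- cls a)
    rw [f.map_neg, g.map_neg, Preadditive.neg_comp, Preadditive.comp_neg, ha]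
  | smul r a ha =>
    change f.map (r • cls a) ≫ _ = _ ≫ g.map (r • cls a)
    rw [f.map_smul, g.map_smul, Linear.smul_comp, Linear.comp_smul, ha]
  | act w h => exact hact w _ _ h
  | tr φ x => exact htr φ x
  | glue h w x => exact hglue h w x
  | glueInv h w x =>
    have e1 : cls (.glue h w x) ≫ cls (.glueInv h w x) = 𝟙 _ := sound (.glue_glueInv h w x)
    have e2 : cls (.glueInv h w x) ≫ cls (.glue h w x) = 𝟙 _ := sound (.glueInv_glue h w x)
    -- Conjugating the square for the gluing arrow by its inverse gives the square for the inverse.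
    have := congr(f.map (cls (.glueInv h w x)) ≫ $(hglue h w x) ≫ g.map (cls (.glueInv h w x)))
    rw [Category.assoc, Category.assoc, ← g.map_comp, e1, g.map_id, ← f.map_comp_assoc, e2,
      f.map_id, Category.id_comp, Category.comp_id] at this
    exact this.symm

end
end Presentation

/-! ### Universal property of the presented category. -/

open Presentation

section
variable {k : Type u} [CommRing k] {J : Type u} [Bicategory.{u, u} J]
  (W : Jᵒᵖ ⥤ᵖ Cat.{u, u}) (F : J ⥤ᵖ LinCat k)

/-- The weighted colimit of a diagram of `k`-linear categories, presented by generators and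
relations. -/
def presented : LinCat k where
  carrier := Obj W F

variable {W F}

/-- The canonical functors into the presented weighted colimit. -/
def presentedFunctor (j : J) (w : W.obj (op j)) : F.obj j ⟶ presented W F :=
  show Hom _ _ from
  { functor :=
      { obj x := ⟨j, w, x⟩
        map f := cls (.act w f)
        map_id x := sound (.act_id w x)
        map_comp f g := sound (.act_comp w f g) }
    additive := ⟨sound (.act_add w _ _)⟩
    linear := ⟨fun f r => sound (.act_smul w r f)⟩ }

/-- The tautological weighted cocone on the presented weighted colimit. -/
def presentedWCocone : WCocone W F (presented W F) where
  obj j w := presentedFunctor j w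
  map {j w w'} φ := Hom₂.mk (F := presentedFunctor j w) (G := presentedFunctor j w')
    { app x := cls (.tr φ x)
      naturality _ _ f := sound (.tr_act φ f) }
  map_id w := hom₂_ext fun x => sound (.tr_id w x)
  map_comp φ ψ := hom₂_ext fun x => sound (.tr_comp φ ψ x)
  glue {j j'} g w := isoMk (F := presentedFunctor j _) (G := F.map g ≫ presentedFunctor j' w)
    (NatIso.ofComponents (fun x =>
      { hom := cls (.glue g w x)
        inv := cls (.glueInv g w x)
        hom_inv_id := sound (.glue_glueInv g w x)
        inv_hom_id := sound (.glueInv_glue g w x) })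
      (fun f => sound (.glue_act g w f)))
  glue_naturality g w w' φ := hom₂_ext fun x => sound (.glue_tr g φ x)
  glue_map₂ θ w := hom₂_ext fun x => sound (.glue_map₂ θ w x)
  glue_id j w := hom₂_ext fun x => by
    refine Eq.trans ?_ (sound (.glue_id w x))
    exact congrArg (cls (.glue (𝟙 j) w x) ≫ ·)
      (Category.comp_id (cls (.act w ((F.mapId j).hom.natTrans.app x))))
  glue_comp g h w := hom₂_ext fun x => by
    refine Eq.trans ?_ (sound (.glue_comp g h w x))
    exact congrArg (cls (.glue (g ≫ h) w x) ≫ ·)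
      (Category.comp_id (cls (.act w ((F.mapComp g h).hom.natTrans.app x))))

variable {D : LinCat k} (c : WCocone W F D)

/-- The object part of the functor induced by a weighted cocone. -/
def evalObj (X : Obj W F) : D.carrier := (c.obj X.idx X.weight).functor.obj X.pt

/-- The value of a formal expression in the vertex of a weighted cocone. -/
def eval : ∀ {X Y : Obj W F}, Word X Y → (evalObj c X ⟶ evalObj c Y)
  | _, _, .idt X => 𝟙 _
  | _, _, .comp a b => eval a ≫ eval b
  | _, _, .zero _ _ => 0
  | _, _, .add a b => eval a + eval b
  | _, _, .neg a => - eval a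
  | _, _, .smul r a => r • eval a
  | _, _, .act w f => (c.obj _ w).functor.map f
  | _, _, .tr φ x => (c.map φ).natTrans.app x
  | _, _, .glue g w x => (c.glue g w).hom.natTrans.app x
  | _, _, .glueInv g w x => (c.glue g w).inv.natTrans.app x

/-- Each relation is sent to an axiom of a `k`-linear category, of a linear functor, of a natural
transformation or of a weighted cocone. -/
lemma eval_rel {X Y : Obj W F} {a b : Word X Y} (h : Rel a b) : eval c a = eval c b := by
  induction h with
  | refl a => rfl
  | symm _ h => exact h.symm
  | trans _ _ h h' => exact h.trans h'
  | comp_congr _ _ h h' => exact congr($h ≫ $h')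
  | add_congr _ _ h h' => exact congr($h + $h')
  | neg_congr _ h => exact congr(- $h)
  | smul_congr r _ h => exact congr(r • $h)
  | id_comp a => exact Category.id_comp _
  | comp_id a => exact Category.comp_id _
  | assoc a b c => exact Category.assoc _ _ _
  | add_assoc a b c => exact add_assoc _ _ _
  | zero_add a => exact zero_add _
  | add_comm a b => exact add_comm _ _
  | neg_add a => exact neg_add_cancel _
  | one_smul a => exact one_smul k _
  | mul_smul r s a => exact mul_smul r s _
  | smul_add r a b => exact smul_add r _ _
  | add_smul r s a => exact add_smul r s _
  | add_comp a b c => exact Preadditive.add_comp _ _ _ _ _ _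
  | comp_add a b c => exact Preadditive.comp_add _ _ _ _ _ _
  | smul_comp r a b => exact Linear.smul_comp _ _ _ _ _ _
  | comp_smul r a b => exact Linear.comp_smul _ _ _ _ _ _
  | act_id w x => exact (c.obj _ w).functor.map_id x
  | act_comp w f g => exact (c.obj _ w).functor.map_comp f g
  | act_add w f g => exact (c.obj _ w).functor.map_add
  | act_smul w r f => exact (c.obj _ w).functor.map_smul r f
  | tr_id w x => exact congr(($(c.map_id w)).natTrans.app x)
  | tr_comp φ ψ x => exact congr(($(c.map_comp φ ψ)).natTrans.app x)
  | tr_act φ f => exact (c.map φ).natTrans.naturality f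
  | glue_glueInv g w x => exact congr(($((c.glue g w).hom_inv_id)).natTrans.app x)
  | glueInv_glue g w x => exact congr(($((c.glue g w).inv_hom_id)).natTrans.app x)
  | glue_act g w f => exact (c.glue g w).hom.natTrans.naturality f
  | glue_tr g φ x => exact congr(($(c.glue_naturality g φ)).natTrans.app x)
  | glue_map₂ θ w x => exact congr(($(c.glue_map₂ θ w)).natTrans.app x)
  | glue_id w x =>
    -- The cocone axiom carries a component of the left unitor, an identity that the relation omits;
    -- likewise below with the associator.
    refine Eq.trans ?_ congr(($(c.glue_id _ w)).natTrans.app x)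
    exact congrArg ((c.glue _ w).hom.natTrans.app x ≫ ·) (Category.comp_id _).symm
  | glue_comp g h w x =>
    refine Eq.trans ?_ congr(($(c.glue_comp g h w)).natTrans.app x)
    exact congrArg ((c.glue _ w).hom.natTrans.app x ≫ ·) (Category.comp_id _).symm

/-- The functor out of the presented weighted colimit induced by a weighted cocone. -/
def presentedDesc : presented W F ⟶ D :=
  show Hom _ _ from
  { functor :=
      { obj := evalObj c
        map := Quotient.lift (eval c) fun _ _ h => eval_rel c h
        map_id _ := rfl
        map_comp {X Y Z} := Mor.ind fun a => Mor.ind fun b => rfl }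
    additive := ⟨fun {X Y f g} => by
      induction f using Mor.ind with | h a => induction g using Mor.ind with | h b => rfl⟩
    linear := ⟨fun f r => by
      induction f using Mor.ind with | h a => rfl⟩ }

/-- Every object lies in the image of exactly one coprojection, so a morphism of cocones already is
a family of components on all objects, and naturality is needed on generators only. The functor
`presentedDesc c` restricts to `c` with identity components. -/
lemma isColim_presentedWCocone :
    (presentedWCocone (W := W) (F := F)).IsColim fun _ => True := fun D _ =>
  { faithful := ⟨fun h => hom₂_ext fun X => congr((($h).app X.idx X.weight).natTrans.app X.pt)⟩
    full := ⟨fun {f g} Γ => by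
      -- Retyping the functors with source `Obj W F` makes the instances on the presentation
      -- available.
      let f' : Obj W F ⥤ D.carrier := f.functor
      let g' : Obj W F ⥤ D.carrier := g.functor
      have : f'.Additive := Hom.additive f
      have : f'.Linear k := Hom.linear f
      have : g'.Additive := Hom.additive g
      have : g'.Linear k := Hom.linear g
      exact ⟨⟨
        { app X := (Γ.app X.idx X.weight).natTrans.app X.pt
          naturality _ _ := Mor.ind fun a => naturality_of_generators
            (f := f') (g := g')
            (fun X => (Γ.app X.idx X.weight).natTrans.app X.pt)
            (fun w _ _ h => (Γ.app _ w).natTrans.naturality h)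
            (fun φ x => congr(($(Γ.naturality φ)).natTrans.app x))
            -- The gluing of a postcomposed cocone ends with an associator, whose components are
            -- identities here.
            (fun h w x => (congrArg (· ≫ _) (Category.comp_id _).symm).trans
              ((congr(($(Γ.glue h w)).natTrans.app x)).symm.trans
                (congrArg (_ ≫ ·) (Category.comp_id _)))) a }⟩, rfl⟩⟩
    essSurj := ⟨fun c => ⟨presentedDesc c, ⟨WCocone.isoMk
      (fun j w => isoMk (F := presentedFunctor j w ≫ presentedDesc c) (G := c.obj j w)
        (NatIso.ofComponents (fun x => Iso.refl ((c.obj j w).functor.obj x))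
          (fun f => (Category.comp_id _).trans (Category.id_comp _).symm)))
      (fun φ => hom₂_ext fun x => (Category.comp_id _).trans (Category.id_comp _).symm)
      (fun h w => hom₂_ext fun x => (Category.id_comp _).trans
        ((Category.comp_id _).trans (Category.comp_id _)).symm)⟩⟩⟩ }

end
end LinCat
end BicatColim

namespace BicatColim

/-- Up to the associator, `postcomposing` for `c.postcomp f` is precomposition with `f` followed by
`postcomposing` for `c`; both are equivalences at objects of `Q`. -/
lemma WCocone.IsColim.postcomp {J : Type u₁} [Bicategory.{w₁, v₁} J] {C : Type u₂}
    [Bicategory.{w₂, v₂} C] {W : Jᵒᵖ ⥤ᵖ Cat.{w₃, u₃}} {F : J ⥤ᵖ C} {X Y : C} {c : WCocone W F X}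
    (hc : c.IsColim fun _ => True) (f : X ⟶ Y) {Q : C → Prop}
    (hf : ∀ i, Q i → (Bicategory.precomp i f).IsEquivalence) : (c.postcomp f).IsColim Q :=
  fun i hi => by
    have := hf i hi
    have := hc i trivial
    exact Functor.isEquivalence_of_iso (F := Bicategory.precomp i f ⋙ c.postcomposing i)
      (NatIso.ofComponents (fun g => (c.postcompAssoc f g).symm)
        (fun η => WCocone.hom_ext fun j w => associator_inv_naturality_right _ _ _))

/-! ### Completions of `k`-linear categories -/

section Extension

variable {k : Type u} [CommRing k] {P : Type u₁} [Category.{v₁} P] [Preadditive P] [Linear k P]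
  {L : Type u₂} [Category.{v₂} L] [Preadditive L] [Linear k L]
  {E : Type u₃} [Category.{v₃} E] [Preadditive E] [Linear k E]

/-- An expression of the identity of `Y` through finitely many objects in the image of `η`. -/
structure Decomposition (η : P ⥤ L) (Y : L) where
  n : ℕ
  X : Fin n → P
  ι (a : Fin n) : η.obj (X a) ⟶ Y
  π (a : Fin n) : Y ⟶ η.obj (X a)
  total : ∑ a, π a ≫ ι a = 𝟙 Y

section
variable (η : P ⥤ L) [η.Full] [η.Faithful] (F : P ⥤ E)

/-- The action of `F` on morphisms between objects in the image of a fully faithful `η`. -/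
noncomputable def mapPreimage {X Y : P} (f : η.obj X ⟶ η.obj Y) : F.obj X ⟶ F.obj Y :=
  F.map (η.preimage f)

omit [Preadditive P] [Preadditive L] [Preadditive E] in
lemma mapPreimage_map {X Y : P} (f : X ⟶ Y) : mapPreimage η F (η.map f) = F.map f := by
  simp [mapPreimage]

omit [Preadditive P] [Preadditive L] [Preadditive E] in
lemma mapPreimage_id (X : P) : mapPreimage η F (𝟙 (η.obj X)) = 𝟙 (F.obj X) := by
  simp [mapPreimage]

omit [Preadditive P] [Preadditive L] [Preadditive E] in
lemma mapPreimage_comp {X Y Z : P} (f : η.obj X ⟶ η.obj Y) (g : η.obj Y ⟶ η.obj Z) :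
    mapPreimage η F (f ≫ g) = mapPreimage η F f ≫ mapPreimage η F g := by
  simp [mapPreimage]

lemma mapPreimage_smul [η.Linear k] [F.Linear k] {X Y : P} (r : k) (f : η.obj X ⟶ η.obj Y) :
    mapPreimage η F (r • f) = r • mapPreimage η F f := by
  rw [mapPreimage, mapPreimage, ← F.map_smul]
  congr 1
  apply η.map_injective
  simp

variable [η.Additive] [F.Additive]

lemma mapPreimage_add {X Y : P} (f g : η.obj X ⟶ η.obj Y) :
    mapPreimage η F (f + g) = mapPreimage η F f + mapPreimage η F g := by
  rw [mapPreimage, mapPreimage, mapPreimage, ← F.map_add]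
  congr 1
  apply η.map_injective
  simp

lemma mapPreimage_sum {X Y : P} {α : Type*} (s : Finset α) (f : α → (η.obj X ⟶ η.obj Y)) :
    mapPreimage η F (∑ a ∈ s, f a) = ∑ a ∈ s, mapPreimage η F (f a) :=
  map_sum (AddMonoidHom.mk' (mapPreimage η F (X := X) (Y := Y)) (mapPreimage_add η F)) f s

variable {η}

/-- A path through `Y` is computed in `E` although `F` has no value at `Y`: `mapPreimage` respects
sums and composition, and the middle factors add up to the identity of `Y`. -/
lemma Decomposition.sum_mapPreimage {Y : L} (d : Decomposition η Y) {A B : P} (f : η.obj A ⟶ Y)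
    (g : Y ⟶ η.obj B) :
    ∑ a, mapPreimage η F (f ≫ d.π a) ≫ mapPreimage η F (d.ι a ≫ g) = mapPreimage η F (f ≫ g) := by
  simp only [← mapPreimage_comp, ← mapPreimage_sum]
  have : ∑ a, (f ≫ d.π a) ≫ d.ι a ≫ g = f ≫ (∑ a, d.π a ≫ d.ι a) ≫ g := by
    simp [Preadditive.comp_sum, Preadditive.sum_comp]
  rw [this, d.total, Category.id_comp]

/-- A realization in `E` of the object decomposed by `d`. -/
structure Realization {Y : L} (d : Decomposition η Y) where
  Z : E
  ι (a : Fin d.n) : F.obj (d.X a) ⟶ Z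
  π (a : Fin d.n) : Z ⟶ F.obj (d.X a)
  ι_π (a b : Fin d.n) : ι a ≫ π b = mapPreimage η F (d.ι a ≫ d.π b)
  total : ∑ a, π a ≫ ι a = 𝟙 Z

variable {F}

namespace Realization

variable {Y : L} {d : Decomposition η Y} (r : Realization F d)

omit [Preadditive P] [η.Faithful] [η.Additive] [F.Additive] in
lemma hom_ext {T : E} {f g : r.Z ⟶ T} (h : ∀ a, r.ι a ≫ f = r.ι a ≫ g) : f = g := by
  rw [← Category.id_comp f, ← Category.id_comp g, ← r.total, Preadditive.sum_comp,
    Preadditive.sum_comp]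
  exact Finset.sum_congr rfl fun a _ => by rw [Category.assoc, Category.assoc, h]

/-- The morphism out of a realization induced by a morphism into an object in the image. -/
noncomputable def toImage {A : P} (f : Y ⟶ η.obj A) : r.Z ⟶ F.obj A :=
  ∑ a, r.π a ≫ mapPreimage η F (d.ι a ≫ f)

lemma ι_toImage {A : P} (f : Y ⟶ η.obj A) (a : Fin d.n) :
    r.ι a ≫ r.toImage f = mapPreimage η F (d.ι a ≫ f) := by
  simp only [toImage, Preadditive.comp_sum, ← Category.assoc, r.ι_π]
  exact (d.sum_mapPreimage F (d.ι a) f)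

lemma toImage_comp_map {A B : P} (f : Y ⟶ η.obj A) (g : A ⟶ B) :
    r.toImage f ≫ F.map g = r.toImage (f ≫ η.map g) := r.hom_ext fun a => by
  rw [reassoc_of% r.ι_toImage f a, r.ι_toImage, ← Category.assoc, mapPreimage_comp, mapPreimage_map]

/-- The morphism between realizations induced by a morphism. -/
noncomputable def map {Y' : L} {d' : Decomposition η Y'} (r' : Realization F d') (m : Y ⟶ Y') :
    r.Z ⟶ r'.Z :=
  ∑ b, r.toImage (m ≫ d'.π b) ≫ r'.ι b

variable {Y' : L} {d' : Decomposition η Y'} (r' : Realization F d')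

lemma ι_map (m : Y ⟶ Y') (a : Fin d.n) :
    r.ι a ≫ r.map r' m = ∑ b, mapPreimage η F (d.ι a ≫ m ≫ d'.π b) ≫ r'.ι b := by
  simp only [map, Preadditive.comp_sum, reassoc_of% (r.ι_toImage · a)]

/-- Tested against the `ι`, this is `sum_mapPreimage` at `Y'`. Functoriality of `map` and naturality
of `extensionIso` both rest on it. -/
lemma map_toImage (m : Y ⟶ Y') {A : P} (f : Y' ⟶ η.obj A) :
    r.map r' m ≫ r'.toImage f = r.toImage (m ≫ f) := r.hom_ext fun a => by
  rw [reassoc_of% r.ι_map r' m a, r.ι_toImage, Preadditive.sum_comp]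
  simp only [Category.assoc, r'.ι_toImage]
  simp only [← Category.assoc]
  exact d'.sum_mapPreimage F _ _

lemma map_id : r.map r (𝟙 Y) = 𝟙 r.Z := r.hom_ext fun a => by
  rw [ι_map]
  simp [← r.ι_π, ← Preadditive.comp_sum, r.total]

lemma map_comp {Y'' : L} {d'' : Decomposition η Y''} (r'' : Realization F d'') (m : Y ⟶ Y')
    (m' : Y' ⟶ Y'') : r.map r'' (m ≫ m') = r.map r' m ≫ r'.map r'' m' := by
  change ∑ b, _ = _ ≫ ∑ b, _
  rw [Preadditive.comp_sum]
  refine Finset.sum_congr rfl fun b _ => ?_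
  rw [← Category.assoc, map_toImage, Category.assoc]

lemma map_add (m m' : Y ⟶ Y') : r.map r' (m + m') = r.map r' m + r.map r' m' :=
  r.hom_ext fun a => by
    simp [ι_map, mapPreimage_add, Finset.sum_add_distrib]

lemma map_smul [η.Linear k] [F.Linear k] (s : k) (m : Y ⟶ Y') :
    r.map r' (s • m) = s • r.map r' m :=
  r.hom_ext fun a => by
    simp [ι_map, mapPreimage_smul, Finset.smul_sum]

/-- The canonical morphism into a realization of an object in the image. -/
noncomputable def ofImage {X : P} {d : Decomposition η (η.obj X)} (r : Realization F d) :
    F.obj X ⟶ r.Z :=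
  ∑ a, mapPreimage η F (d.π a) ≫ r.ι a

/-- The decomposition of `η.obj X` is arbitrary, so the realization is only isomorphic to `F.obj X`;
this and the next lemma give the isomorphism. -/
lemma toImage_ofImage {X : P} {d : Decomposition η (η.obj X)} (r : Realization F d) :
    r.toImage (𝟙 (η.obj X)) ≫ r.ofImage = 𝟙 r.Z := r.hom_ext fun a => by
  rw [ofImage, reassoc_of% r.ι_toImage _ a, Category.comp_id, Preadditive.comp_sum, Category.comp_id]
  simp only [← Category.assoc, ← mapPreimage_comp, ← r.ι_π]
  simp only [Category.assoc, ← Preadditive.comp_sum, r.total, Category.comp_id]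

lemma ofImage_toImage {X : P} {d : Decomposition η (η.obj X)} (r : Realization F d) :
    r.ofImage ≫ r.toImage (𝟙 (η.obj X)) = 𝟙 (F.obj X) := by
  simp only [ofImage, Preadditive.sum_comp, Category.assoc, ι_toImage]
  have := d.sum_mapPreimage F (𝟙 _) (𝟙 _)
  simpa only [Category.id_comp, mapPreimage_id] using this

end Realization

variable {d : ∀ Y, Decomposition η Y} (r : ∀ Y, Realization F (d Y))

/-- The extension of `F` along `η`. -/
noncomputable def extension : L ⥤ E where
  obj Y := (r Y).Z
  map m := (r _).map (r _) m
  map_id Y := (r Y).map_id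
  map_comp m m' := (r _).map_comp _ _ m m'

instance : (extension r).Additive where
  map_add := (r _).map_add _ _ _

instance [η.Linear k] [F.Linear k] : (extension r).Linear k where
  map_smul f s := (r _).map_smul _ s f

/-- The extension of `F` along `η` restricts to `F`. -/
noncomputable def extensionIso : η ⋙ extension r ≅ F :=
  NatIso.ofComponents (fun X =>
    { hom := (r _).toImage (𝟙 (η.obj X))
      inv := (r (η.obj X)).ofImage
      hom_inv_id := (r _).toImage_ofImage
      inv_hom_id := (r _).ofImage_toImage })
    (fun {X Y} f => by
      change (r _).map (r _) (η.map f) ≫ (r _).toImage (𝟙 _) = (r _).toImage (𝟙 _) ≫ F.map f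
      rw [Realization.map_toImage, Realization.toImage_comp_map, Category.id_comp,
        Category.comp_id])

end

variable {η : P ⥤ L} (d : ∀ Y, Decomposition η Y) {G H : L ⥤ E}

-- Inserting the decomposition of the identity of `Y` writes the component at `Y` as a sum of terms
-- through components at objects `η.obj X`.
omit [Preadditive P] in
include d in
lemma natTrans_ext_of_decomposition [G.Additive] {α β : G ⟶ H}
    (h : ∀ X, α.app (η.obj X) = β.app (η.obj X)) : α = β := by
  ext Y
  have key (γ : G ⟶ H) : γ.app Y = ∑ a, G.map ((d Y).π a) ≫ γ.app _ ≫ H.map ((d Y).ι a) := by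
    have : γ.app Y = G.map (∑ a, (d Y).π a ≫ (d Y).ι a) ≫ γ.app Y := by
      rw [(d Y).total, G.map_id, Category.id_comp]
    rw [this, G.map_sum, Preadditive.sum_comp]
    simp
  rw [key α, key β]
  simp only [h]

-- The formula that forces uniqueness, `∑ G(π) ≫ τ ≫ H(ι)`, is taken as the definition of the
-- component at `Y`.
omit [Preadditive P] in
include d in
lemma exists_natTrans_of_decomposition [η.Full] [G.Additive] [H.Additive] (τ : η ⋙ G ⟶ η ⋙ H) :
    ∃ α : G ⟶ H, ∀ X, α.app (η.obj X) = τ.app X := by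
  have nat {A B : P} (f : η.obj A ⟶ η.obj B) : G.map f ≫ τ.app B = τ.app A ≫ H.map f := by
    obtain ⟨f, rfl⟩ := η.map_surjective f
    exact τ.naturality f
  -- Naturality for morphisms out of an object in the image. With `f` an identity it shows that the
  -- extension restricts to `τ`; for general `m`, `G.map m` is first split into such morphisms.
  have h1 {A : P} {Y : L} (f : η.obj A ⟶ Y) : G.map f ≫ ∑ a, G.map ((d Y).π a) ≫ τ.app _ ≫
      H.map ((d Y).ι a) = τ.app A ≫ H.map f := by
    have : H.map f = H.map (f ≫ ∑ a, (d Y).π a ≫ (d Y).ι a) := by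
      rw [(d Y).total, Category.comp_id]
    rw [this, Preadditive.comp_sum, Preadditive.comp_sum, H.map_sum, Preadditive.comp_sum]
    refine Finset.sum_congr rfl fun a _ => ?_
    rw [← Category.assoc f, H.map_comp, ← reassoc_of% nat, G.map_comp, Category.assoc]
  refine ⟨{ app Y := ∑ a, G.map ((d Y).π a) ≫ τ.app _ ≫ H.map ((d Y).ι a), naturality := ?_ },
    fun X => ?_⟩
  · intro Y Y' m
    have : G.map m = ∑ a, G.map ((d Y).π a) ≫ G.map ((d Y).ι a ≫ m) := by
      simp only [← G.map_comp, ← G.map_sum]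
      simp only [← Category.assoc, ← Preadditive.sum_comp, (d Y).total, Category.id_comp]
    rw [this]
    rw [Preadditive.sum_comp, Preadditive.sum_comp]
    refine Finset.sum_congr rfl fun a _ => ?_
    rw [Category.assoc, h1, H.map_comp]
    simp
  · simpa using h1 (𝟙 (η.obj X))

end Extension

namespace LinCat

variable {k : Type u} [CommRing k]

/-- Full faithfulness of the restriction uses only the decompositions; the completeness of `E`
enters only in essential surjectivity, through the realizations. -/
lemma isEquivalence_precomp {P L : LinCat k} (η : P ⟶ L) [η.functor.Full] [η.functor.Faithful]
    (d : ∀ Y, Decomposition η.functor Y) {E : LinCat k}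
    (r : ∀ (F : P ⟶ E) (Y), Nonempty (Realization F.functor (d Y))) :
    (Bicategory.precomp E η).IsEquivalence where
  faithful := ⟨fun {f g α β} h => Hom₂.ext (natTrans_ext_of_decomposition d
    fun X => congr(($h).natTrans.app X))⟩
  full := ⟨fun {f g} τ => by
    obtain ⟨α, hα⟩ := exists_natTrans_of_decomposition d (G := f.functor) (H := g.functor)
      τ.natTrans
    exact ⟨⟨α⟩, hom₂_ext hα⟩⟩
  essSurj := ⟨fun F => by
    let r' Y := (r F Y).some
    exact ⟨show Hom _ _ from { functor := extension r' }, ⟨isoMk (extensionIso r')⟩⟩⟩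

end LinCat

end BicatColim

namespace BicatColim

/-! ### Matrix categories and Karoubi envelopes. -/

section Mat

variable {k : Type u} [CommRing k] (P : Type u₁) [Category.{v₁} P] [Preadditive P] [Linear k P]

instance Mat_.linear : Linear k (Mat_ P) where
  homModule M N := inferInstanceAs (Module k (∀ (i : M.ι) (j : N.ι), M.X i ⟶ N.X j))
  smul_comp M N K r f g := by
    ext i j
    change ∑ l, (r • f i l) ≫ g l j = r • ∑ l, f i l ≫ g l j
    simp [Finset.smul_sum]
  comp_smul M N K f r g := by
    ext i j
    change ∑ l, f i l ≫ (r • g l j) = r • ∑ l, f i l ≫ g l j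
    simp [Finset.smul_sum]

variable {P} in
lemma Mat_.sum_apply {M N : Mat_ P} {α : Type*} (s : Finset α) (f : α → (M ⟶ N)) (i : M.ι)
    (j : N.ι) : (∑ a ∈ s, f a) i j = ∑ a ∈ s, f a i j :=
  map_sum (AddMonoidHom.mk' (fun f : M ⟶ N => f i j) fun _ _ => rfl) f s

instance Karoubi.linear : Linear k (Idempotents.Karoubi P) where
  homModule M N :=
    { smul r f := ⟨r • f.f, by simp⟩
      one_smul f := Idempotents.Karoubi.hom_ext _ _ (one_smul k f.f)
      mul_smul r s f := Idempotents.Karoubi.hom_ext _ _ (mul_smul r s f.f)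
      smul_zero r := Idempotents.Karoubi.hom_ext _ _ (smul_zero r)
      smul_add r f g := Idempotents.Karoubi.hom_ext _ _ (smul_add r f.f g.f)
      add_smul r s f := Idempotents.Karoubi.hom_ext _ _ (add_smul r s f.f)
      zero_smul f := Idempotents.Karoubi.hom_ext _ _ (zero_smul k f.f) }
  smul_comp M N K r f g := Idempotents.Karoubi.hom_ext _ _ (Linear.smul_comp _ _ _ r f.f g.f)
  comp_smul M N K f r g := Idempotents.Karoubi.hom_ext _ _ (Linear.comp_smul _ _ _ f.f r g.f)

/-- The additive completion of a preadditive category: finite lists of objects and matrices. -/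
abbrev FinMat := InducedCategory (Mat_ P) fun M : Σ n, Fin n → P => ⟨Fin M.1, M.2⟩

namespace FinMat

/-- Enumerating the index type shows that lists lose no object up to isomorphism. Indexing by `Fin
n` keeps the objects in the universe of `P`, as a small category requires. -/
instance : (inducedFunctor fun M : Σ n, Fin n → P => (⟨Fin M.1, M.2⟩ : Mat_ P)).EssSurj where
  mem_essImage M := by
    let e := Fintype.equivFin M.ι
    let N : FinMat P := ⟨_, fun a => M.X (e.symm a)⟩
    refine ⟨N, ⟨Mat_.isoBiproductEmbedding _ ≪≫ biproduct.whiskerEquiv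
      (f := fun a => (Mat_.embedding P).obj (M.X (e.symm a)))
      (g := fun i => (Mat_.embedding P).obj (M.X i)) e.symm (fun _ => Iso.refl _) ≪≫ (Mat_.isoBiproductEmbedding M).symm⟩⟩

/-- Finite products are transported along the equivalence with `Mat_ P`; in a preadditive category
they are biproducts. -/
instance : HasFiniteBiproducts (FinMat P) := by
  let F : FinMat P ⥤ Mat_ P := inducedFunctor _
  have : F.IsEquivalence := {}
  have : HasFiniteProducts (FinMat P) :=
    ⟨fun n => Adjunction.hasLimitsOfShape_of_equivalence F⟩
  exact HasFiniteBiproducts.of_hasFiniteProducts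

/-- The embedding of a preadditive category into its additive completion. -/
def embedding : P ⥤ FinMat P where
  obj X := ⟨1, fun _ => X⟩
  map f := ⟨fun _ _ => f⟩
  map_id X := by
    apply InducedCategory.hom_ext
    refine Mat_.hom_ext _ _ fun i j => ?_
    obtain rfl := Subsingleton.elim i j
    exact (Mat_.id_apply_self _ i).symm
  map_comp f g := by
    apply InducedCategory.hom_ext
    refine Mat_.hom_ext _ _ fun i j => ?_
    exact (Finset.sum_singleton _ _).symm

instance : (embedding P).Full where
  map_surjective f := ⟨f.hom (0 : Fin 1) (0 : Fin 1), by
    apply InducedCategory.hom_ext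
    refine Mat_.hom_ext _ _ fun i j => ?_
    obtain rfl := Subsingleton.elim (α := Fin 1) i 0
    obtain rfl := Subsingleton.elim (α := Fin 1) j 0
    rfl⟩

instance : (embedding P).Faithful where
  map_injective h := congr(($h).hom (0 : Fin 1) (0 : Fin 1))

instance : (embedding P).Additive where
  map_add := rfl

instance : (embedding P).Linear k where
  map_smul _ _ := rfl

variable {P}

/-- The coprojection of a summand. -/
def ι (Y : FinMat P) (a : Fin Y.1) : (embedding P).obj (Y.2 a) ⟶ Y :=
  ⟨fun _ j => if h : a = j then eqToHom (congrArg Y.2 h) else 0⟩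

/-- The projection onto a summand. -/
def π (Y : FinMat P) (a : Fin Y.1) : Y ⟶ (embedding P).obj (Y.2 a) :=
  ⟨fun i _ => if h : i = a then eqToHom (congrArg Y.2 h) else 0⟩

/-- Writing the composite as the image of a morphism of `P` lets `mapPreimage_map` evaluate it. -/
lemma ι_π (Y : FinMat P) (a b : Fin Y.1) : ι Y a ≫ π Y b =
    (embedding P).map (if h : a = b then eqToHom (congrArg Y.2 h) else 0) := by
  apply InducedCategory.hom_ext
  refine Mat_.hom_ext _ _ fun i j => ?_
  change ∑ l, (if h : a = l then eqToHom (congrArg Y.2 h) else 0) ≫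
    (if h : l = b then eqToHom (congrArg Y.2 h) else 0) = dite _ _ _
  simp [dite_comp, comp_dite]

/-- An object of the additive completion is the direct sum of its entries. -/
def decomposition (Y : FinMat P) : Decomposition (embedding P) Y where
  n := Y.1
  X := Y.2
  ι := ι Y
  π := π Y
  total := by
    apply InducedCategory.homAddEquiv.injective
    rw [map_sum]
    refine Mat_.hom_ext _ _ fun i j => ?_
    rw [Mat_.sum_apply]
    change ∑ a, ∑ l : Fin 1, (if h : i = a then eqToHom (congrArg Y.2 h) else 0) ≫
      (if h : a = j then eqToHom (congrArg Y.2 h) else 0) = (𝟙 (Mat_.mk (Fin Y.1) Y.2)) i j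
    simp [dite_comp, comp_dite, Mat_.id_apply]

/-- In an additive category, the direct sums realize the objects of the additive completion. -/
noncomputable def realization {E : Type u₃} [Category.{v₃} E] [Preadditive E]
    [HasFiniteBiproducts E] (F : P ⥤ E) [F.Additive] (Y : FinMat P) :
    Realization F (decomposition Y) where
  Z := ⨁ fun a : Fin Y.1 => F.obj (Y.2 a)
  ι a := biproduct.ι (fun a : Fin Y.1 => F.obj (Y.2 a)) a
  π a := biproduct.π (fun a : Fin Y.1 => F.obj (Y.2 a)) a
  ι_π := fun (a b : Fin Y.1) => by
    change biproduct.ι (fun a : Fin Y.1 => F.obj (Y.2 a)) a ≫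
      biproduct.π (fun a : Fin Y.1 => F.obj (Y.2 a)) b =
        mapPreimage (X := Y.2 a) (Y := Y.2 b) (embedding P) F (ι Y a ≫ π Y b)
    rw [ι_π, mapPreimage_map, biproduct.ι_π]
    split_ifs <;> simp [eqToHom_map]
  total := biproduct.total (f := fun a : Fin Y.1 => F.obj (Y.2 a))

end FinMat

namespace Karoubi

open Idempotents Idempotents.Karoubi

instance : (toKaroubi P).Linear k where
  map_smul _ _ := rfl

variable {P}

/-- An object of the idempotent completion is a retract of an object of the category. -/
def decomposition (Y : Karoubi P) : Decomposition (toKaroubi P) Y where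
  n := 1
  X _ := Y.X
  ι _ := decompId_p Y
  π _ := decompId_i Y
  total := by simp [← decompId]

/-- Splittings of idempotents realize the objects of the idempotent completion. -/
lemma nonempty_realization {E : Type u₃} [Category.{v₃} E] [Preadditive E]
    [IsIdempotentComplete E] (F : P ⥤ E) [F.Additive] (Y : Karoubi P) :
    Nonempty (Realization F (decomposition Y)) := by
  obtain ⟨Z, i, e, h, h'⟩ := IsIdempotentComplete.idempotents_split (F.obj Y.X) (F.map Y.p)
    (by rw [← F.map_comp, Y.idem])
  exact ⟨{  Z := Z
            ι _ := e
            π _ := i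
            ι_π _ _ := by
              -- The composite of retraction and inclusion is the image of the idempotent `Y.p`, so
              -- the condition is the splitting equation for `F.map Y.p`.
              change _ = mapPreimage (toKaroubi P) F (X := Y.X) (Y := Y.X)
                (decompId_p Y ≫ decompId_i Y)
              rw [← decomp_p, mapPreimage_map]
              exact h'
            total := (Finset.sum_singleton _ _).trans h }⟩

end Karoubi

end Mat

end BicatColim

/-! ### Weighted colimits in the 2-categories of completed `k`-linear categories. -/

namespace BicatColim

/-- Every weighted diagram of small shape has a colimit cocone. -/
def HasWeightedColimits (C : Type v) [Bicategory.{u, u} C] : Prop :=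
  ∀ (J : Type u) [Bicategory.{u, u} J] (W : Jᵒᵖ ⥤ᵖ Cat.{u, u}) (F : J ⥤ᵖ C),
    ∃ (X : C) (c : WCocone W F X), c.IsColim fun _ => True

namespace LinCat

variable {k : Type u} [CommRing k]

lemma exists_additive_completion (P : LinCat k) :
    ∃ L : LinCat k, HasFiniteBiproducts L.carrier ∧ ∃ η : P ⟶ L,
      ∀ E : LinCat k, HasFiniteBiproducts E.carrier → (Bicategory.precomp E η).IsEquivalence := by
  let L : LinCat k := { carrier := FinMat P.carrier }
  let η : P ⟶ L := show Hom _ _ from { functor := FinMat.embedding P.carrier }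
  have : η.functor.Full := inferInstanceAs (FinMat.embedding P.carrier).Full
  have : η.functor.Faithful := inferInstanceAs (FinMat.embedding P.carrier).Faithful
  exact ⟨L, inferInstanceAs (HasFiniteBiproducts (FinMat P.carrier)), η, fun E hE =>
    isEquivalence_precomp η FinMat.decomposition fun F Y => ⟨FinMat.realization F.functor Y⟩⟩

/-- The clause on biproducts is what allows this completion to be applied after the additive one. -/
lemma exists_idempotent_completion (P : LinCat k) :
    ∃ L : LinCat k, IsIdempotentComplete L.carrier ∧
      (HasFiniteBiproducts P.carrier → HasFiniteBiproducts L.carrier) ∧ ∃ η : P ⟶ L,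
      ∀ E : LinCat k, IsIdempotentComplete E.carrier → (Bicategory.precomp E η).IsEquivalence := by
  let L : LinCat k := { carrier := Idempotents.Karoubi P.carrier }
  let η : P ⟶ L := show Hom _ _ from { functor := Idempotents.toKaroubi P.carrier }
  have : η.functor.Full := inferInstanceAs (Idempotents.toKaroubi P.carrier).Full
  have : η.functor.Faithful := inferInstanceAs (Idempotents.toKaroubi P.carrier).Faithful
  exact ⟨L, inferInstanceAs (IsIdempotentComplete (Idempotents.Karoubi P.carrier)),
    fun _ => inferInstanceAs (HasFiniteBiproducts (Idempotents.Karoubi P.carrier)), η, fun E hE =>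
    isEquivalence_precomp η Karoubi.decomposition
      fun F Y => Karoubi.nonempty_realization F.functor Y⟩

/-- The order matters: the Karoubi envelope of an additive category is additive, whereas matrices
over an idempotent split category need not be idempotent split. -/
lemma exists_additive_idempotent_completion (P : LinCat k) :
    ∃ L : LinCat k, (HasFiniteBiproducts L.carrier ∧ IsIdempotentComplete L.carrier) ∧
      ∃ η : P ⟶ L, ∀ E : LinCat k, HasFiniteBiproducts E.carrier ∧
        IsIdempotentComplete E.carrier → (Bicategory.precomp E η).IsEquivalence := by
  obtain ⟨M, hM, η, hη⟩ := exists_additive_completion P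
  obtain ⟨L, hL, hML, θ, hθ⟩ := exists_idempotent_completion M
  refine ⟨L, ⟨hML hM, hL⟩, η ≫ θ, fun E hE => ?_⟩
  have := hη E hE.1
  have := hθ E hE.2
  exact Functor.isEquivalence_of_iso (F := Bicategory.precomp E θ ⋙ Bicategory.precomp E η)
    (associatorNatIsoRight η θ E).symm

/-- The colimit in the sub-2-category is the completion of the colimit in `Cat_k`, as for a
reflective subcategory. -/
lemma hasWeightedColimits_fullSubbicategory {D : LinCat k → Prop}
    (h : ∀ P : LinCat k, ∃ L : LinCat k, D L ∧ ∃ η : P ⟶ L,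
      ∀ E : LinCat k, D E → (Bicategory.precomp E η).IsEquivalence) :
    HasWeightedColimits.{u} (FullSubbicategory (LinCat k) D) := fun J _ W F => by
  obtain ⟨L, hL, η, hη⟩ := h (presented W (FullSubbicategory.val F))
  exact ⟨⟨L, hL⟩, _, FullSubbicategory.isColim_liftWCocone (X := ⟨L, hL⟩)
    (isColim_presentedWCocone.postcomp η hη)⟩

lemma hasWeightedColimits_additive : HasWeightedColimits.{u} (AdditiveLinCat k) :=
  hasWeightedColimits_fullSubbicategory exists_additive_completion

lemma hasWeightedColimits_idempotentSplit :
    HasWeightedColimits.{u} (IdempotentSplitLinCat k) :=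
  hasWeightedColimits_fullSubbicategory fun P =>
    have ⟨L, hL, _, η, hη⟩ := exists_idempotent_completion P
    ⟨L, hL, η, hη⟩

lemma hasWeightedColimits_additiveIdempotentSplit :
    HasWeightedColimits.{u} (AdditiveIdempotentSplitLinCat k) :=
  hasWeightedColimits_fullSubbicategory exists_additive_idempotent_completion

end LinCat

lemma HasWeightedColimits.bicategoricallyCocomplete {C : Type v} [Bicategory.{u, u} C]
    (h : HasWeightedColimits.{u} C) : BicategoricallyCocomplete.{u} C := fun J _ W F => by
  obtain ⟨X, c, hc⟩ := h J W F
  exact ⟨hc.weightedColimit⟩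

end BicatColim

namespace BicatColim

/-! ### Pseudofunctors and strong transformations detected by jointly faithful families -/

section JointlyFaithful

variable {B : Type u₁} [Bicategory.{w₁, v₁} B] {C : Type u₂} [Bicategory.{w₂, v₂} C]

/-- A family of 1-cells out of `p` is jointly faithful if 2-cells between 1-cells out of `p` are
detected by whiskering with the members of the family. -/
def JointlyFaithful {S : Type*} {x : S → C} {p : C} (f : ∀ s, x s ⟶ p) : Prop :=
  ∀ ⦃i : C⦄ ⦃m m' : p ⟶ i⦄ (α β : m ⟶ m'), (∀ s, f s ◁ α = f s ◁ β) → α = β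

/-- The data of a pseudofunctor `B ⥤ᵖ C` together with a jointly faithful family of strong
transformations from pseudofunctors `X s`. -/
structure PseudofunctorData {S : Type u₃} (X : S → B ⥤ᵖ C) where
  obj (b : B) : C
  map {a b : B} (f : a ⟶ b) : obj a ⟶ obj b
  map₂ {a b : B} {f g : a ⟶ b} (η : f ⟶ g) : map f ⟶ map g
  mapId (a : B) : map (𝟙 a) ≅ 𝟙 (obj a)
  mapComp {a b c : B} (f : a ⟶ b) (g : b ⟶ c) : map (f ≫ g) ≅ map f ≫ map g
  app (s : S) (b : B) : (X s).obj b ⟶ obj b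
  jointlyFaithful (b : B) : JointlyFaithful fun s => app s b
  naturality (s : S) {a b : B} (f : a ⟶ b) : (X s).map f ≫ app s b ≅ app s a ≫ map f
  naturality_naturality (s : S) {a b : B} {f g : a ⟶ b} (η : f ⟶ g) :
    (X s).map₂ η ▷ app s b ≫ (naturality s g).hom = (naturality s f).hom ≫ app s a ◁ map₂ η
  naturality_id (s : S) (a : B) : (naturality s (𝟙 a)).hom ≫ app s a ◁ (mapId a).hom =
    ((X s).mapId a).hom ▷ app s a ≫ (λ_ (app s a)).hom ≫ (ρ_ (app s a)).inv
  naturality_comp (s : S) {a b c : B} (f : a ⟶ b) (g : b ⟶ c) :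
    (naturality s (f ≫ g)).hom ≫ app s a ◁ (mapComp f g).hom =
      ((X s).mapComp f g).hom ▷ app s c ≫ (α_ _ _ _).hom ≫
        (X s).map f ◁ (naturality s g).hom ≫ (α_ _ _ _).inv ≫
          (naturality s f).hom ▷ map g ≫ (α_ _ _ _).hom

namespace PseudofunctorData

variable {S : Type u₃} {X : S → B ⥤ᵖ C} (D : PseudofunctorData X)

/-- Prefixing the invertible constraint puts both sides in the shape of the axioms of
`PseudofunctorData`. Each law below then becomes the same law in `X s`, up to interchange and
coherence. -/
lemma ext {a b : B} {f : a ⟶ b} {m : D.obj a ⟶ D.obj b} {α β : D.map f ⟶ m}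
    (h : ∀ s, (D.naturality s f).hom ≫ D.app s a ◁ α = (D.naturality s f).hom ≫ D.app s a ◁ β) :
    α = β :=
  D.jointlyFaithful a α β fun s => (cancel_epi _).1 (h s)

lemma map₂_comp {a b : B} {f g h : a ⟶ b} (η : f ⟶ g) (θ : g ⟶ h) :
    D.map₂ (η ≫ θ) = D.map₂ η ≫ D.map₂ θ := D.ext fun s => by
  rw [← D.naturality_naturality, whiskerLeft_comp, ← reassoc_of% D.naturality_naturality s η,
    ← D.naturality_naturality, (X s).map₂_comp, comp_whiskerRight, Category.assoc]

lemma map₂_whisker_left {a b c : B} (f : a ⟶ b) {g h : b ⟶ c} (η : g ⟶ h) :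
    D.map₂ (f ◁ η) = (D.mapComp f g).hom ≫ D.map f ◁ D.map₂ η ≫ (D.mapComp f h).inv := by
  -- Clearing the inverse leaves `mapComp` only in the direction that `naturality_comp` describes.
  rw [← cancel_mono (D.mapComp f h).hom]
  refine D.ext fun s => ?_
  have h1 := D.naturality_naturality s η
  have h2 := congr((X s).map f ◁ $h1)
  simp only [whiskerLeft_comp] at h2
  simp only [Category.assoc, Iso.inv_hom_id, Category.comp_id, whiskerLeft_comp]
  rw [← reassoc_of% D.naturality_naturality s (f ◁ η), D.naturality_comp,
    reassoc_of% D.naturality_comp s f g]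
  simp [reassoc_of% h2]
  rw [← associator_naturality_right, ← whisker_exchange_assoc,
    ← associator_inv_naturality_right_assoc]

lemma map₂_whisker_right {a b c : B} {f g : a ⟶ b} (η : f ⟶ g) (h : b ⟶ c) :
    D.map₂ (η ▷ h) = (D.mapComp f h).hom ≫ D.map₂ η ▷ D.map h ≫ (D.mapComp g h).inv := by
  rw [← cancel_mono (D.mapComp g h).hom]
  refine D.ext fun s => ?_
  have h1 := D.naturality_naturality s η
  have h2 := congr($h1 ▷ D.map h)
  simp only [comp_whiskerRight] at h2
  simp only [Category.assoc, Iso.inv_hom_id, Category.comp_id, whiskerLeft_comp]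
  rw [← reassoc_of% D.naturality_naturality s (η ▷ h), D.naturality_comp,
    reassoc_of% D.naturality_comp s f h]
  simp
  rw [associator_naturality_left_assoc, ← whisker_exchange_assoc,
    associator_inv_naturality_left_assoc, reassoc_of% h2, associator_naturality_middle]

lemma map₂_left_unitor {a b : B} (f : a ⟶ b) :
    D.map₂ (λ_ f).hom = (D.mapComp (𝟙 a) f).hom ≫ (D.mapId a).hom ▷ D.map f ≫
      (λ_ (D.map f)).hom := by
  refine D.ext fun s => ?_
  have h1 := congr($(D.naturality_id s a) ▷ D.map f)
  simp only [comp_whiskerRight] at h1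
  rw [whiskerLeft_comp, ← D.naturality_naturality, reassoc_of% D.naturality_comp s (𝟙 a) f]
  simp
  rw [← associator_naturality_middle_assoc, reassoc_of% h1, ← associator_inv_naturality_left_assoc,
    whisker_exchange_assoc, ← associator_naturality_left_assoc]
  simp

lemma map₂_right_unitor {a b : B} (f : a ⟶ b) :
    D.map₂ (ρ_ f).hom = (D.mapComp f (𝟙 b)).hom ≫ D.map f ◁ (D.mapId b).hom ≫
      (ρ_ (D.map f)).hom := by
  refine D.ext fun s => ?_
  have h1 := congr((X s).map f ◁ $(D.naturality_id s b))
  simp only [whiskerLeft_comp] at h1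
  rw [whiskerLeft_comp, ← D.naturality_naturality, reassoc_of% D.naturality_comp s f (𝟙 b)]
  simp
  rw [← associator_naturality_right_assoc, ← whisker_exchange_assoc,
    ← associator_inv_naturality_right_assoc, reassoc_of% h1]
  simp

lemma map₂_associator {a b c d : B} (f : a ⟶ b) (g : b ⟶ c) (h : c ⟶ d) :
    D.map₂ (α_ f g h).hom = (D.mapComp (f ≫ g) h).hom ≫ (D.mapComp f g).hom ▷ D.map h ≫
      (α_ (D.map f) (D.map g) (D.map h)).hom ≫ D.map f ◁ (D.mapComp g h).inv ≫
        (D.mapComp f (g ≫ h)).inv := by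
  rw [← cancel_mono (D.mapComp f (g ≫ h)).hom, ← cancel_mono (D.map f ◁ (D.mapComp g h).hom)]
  simp only [Category.assoc, Iso.inv_hom_id, whiskerLeft_inv_hom,
    Category.comp_id]
  refine D.ext fun s => ?_
  have h1 := congr((X s).map f ◁ $(D.naturality_comp s g h))
  have h2 := congr($(D.naturality_comp s f g) ▷ D.map h)
  simp only [whiskerLeft_comp] at h1
  simp only [comp_whiskerRight] at h2
  rw [whiskerLeft_comp, whiskerLeft_comp, whiskerLeft_comp, whiskerLeft_comp,
    ← reassoc_of% D.naturality_naturality s (α_ f g h).hom,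
    reassoc_of% D.naturality_comp s f (g ≫ h), reassoc_of% D.naturality_comp s (f ≫ g) h]
  -- Interchange moves the constraints to where `h1` and `h2` expand them; what is left is the
  -- associator law of `X s`.
  rw [← associator_naturality_right, ← whisker_exchange_assoc,
    ← associator_inv_naturality_right_assoc, reassoc_of% h1,
    ← associator_naturality_middle_assoc (D.app s a), reassoc_of% h2,
    ← associator_inv_naturality_left_assoc, whisker_exchange_assoc,
    ← associator_naturality_left_assoc]
  simp

/-- The pseudofunctor defined by the data. -/
def toPseudofunctor : B ⥤ᵖ C where
  obj := D.obj
  map := D.map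
  map₂ := D.map₂
  mapId := D.mapId
  mapComp := D.mapComp
  map₂_id f := D.ext fun s => by simp [← D.naturality_naturality]
  map₂_comp := D.map₂_comp
  map₂_whisker_left := D.map₂_whisker_left
  map₂_whisker_right := D.map₂_whisker_right
  map₂_associator := D.map₂_associator
  map₂_left_unitor := D.map₂_left_unitor
  map₂_right_unitor := D.map₂_right_unitor

/-- The jointly faithful strong transformations into the pseudofunctor defined by the data. -/
def strongTrans (s : S) : X s ⟶ D.toPseudofunctor where
  app := D.app s
  naturality := D.naturality s
  naturality_naturality := D.naturality_naturality s
  naturality_id := D.naturality_id s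
  naturality_comp := D.naturality_comp s

end PseudofunctorData

/-- The data of a strong transformation `P ⟶ G` together with isomorphisms between its
composites with a jointly faithful family of strong transformations `U s : X s ⟶ P` and strong
transformations `V s : X s ⟶ G`. -/
structure StrongTransData {S : Type u₃} {X : S → B ⥤ᵖ C} {P G : B ⥤ᵖ C} (U : ∀ s, X s ⟶ P)
    (V : ∀ s, X s ⟶ G) where
  jointlyFaithful (b : B) : JointlyFaithful fun s => (U s).app b
  app (b : B) : P.obj b ⟶ G.obj b
  naturality {a b : B} (f : a ⟶ b) : P.map f ≫ app b ≅ app a ≫ G.map f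
  iso (s : S) (b : B) : (U s).app b ≫ app b ≅ (V s).app b
  compat (s : S) {a b : B} (f : a ⟶ b) :
    (α_ _ _ _).inv ≫ ((U s).naturality f).hom ▷ app b ≫ (α_ _ _ _).hom ≫
      (U s).app a ◁ (naturality f).hom ≫ (α_ _ _ _).inv ≫ (iso s a).hom ▷ G.map f =
    (X s).map f ◁ (iso s b).hom ≫ ((V s).naturality f).hom

namespace StrongTransData

variable {S : Type u₃} {X : S → B ⥤ᵖ C} {P G : B ⥤ᵖ C} {U : ∀ s, X s ⟶ P} {V : ∀ s, X s ⟶ G}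
  (D : StrongTransData U V)

/-- The isomorphisms around `α` and `β` complete them to the left side of `compat`, so that the laws
for `naturality` turn into those of `V s`. -/
lemma ext {a b : B} {f : a ⟶ b} {m : G.obj a ⟶ G.obj b}
    {α β : P.map f ≫ D.app b ⟶ D.app a ≫ m}
    (h : ∀ s, (α_ _ _ _).inv ≫ ((U s).naturality f).hom ▷ D.app b ≫ (α_ _ _ _).hom ≫
        (U s).app a ◁ α ≫ (α_ _ _ _).inv ≫ (D.iso s a).hom ▷ m =
      (α_ _ _ _).inv ≫ ((U s).naturality f).hom ▷ D.app b ≫ (α_ _ _ _).hom ≫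
        (U s).app a ◁ β ≫ (α_ _ _ _).inv ≫ (D.iso s a).hom ▷ m) :
    α = β :=
  D.jointlyFaithful a α β fun s => by
    simpa only [cancel_epi, ← Category.assoc, cancel_mono] using h s

lemma naturality_naturality {a b : B} {f g : a ⟶ b} (η : f ⟶ g) :
    P.map₂ η ▷ D.app b ≫ (D.naturality g).hom = (D.naturality f).hom ≫ D.app a ◁ G.map₂ η := by
  refine D.ext fun s => ?_
  have h1 := congr($((U s).naturality_naturality η) ▷ D.app b)
  simp only [comp_whiskerRight] at h1
  rw [whiskerLeft_comp, whiskerLeft_comp, Category.assoc, Category.assoc,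
    ← associator_naturality_middle_assoc, ← reassoc_of% h1, ← associator_inv_naturality_left_assoc,
    D.compat, associator_inv_naturality_right_assoc, whisker_exchange, reassoc_of% D.compat s,
    ← (V s).naturality_naturality, whisker_exchange_assoc]

lemma naturality_id (a : B) :
    (D.naturality (𝟙 a)).hom ≫ D.app a ◁ (G.mapId a).hom =
      (P.mapId a).hom ▷ D.app a ≫ (λ_ (D.app a)).hom ≫ (ρ_ (D.app a)).inv := by
  refine D.ext fun s => ?_
  have h1 := congr($((U s).naturality_id a) ▷ D.app a)
  simp only [comp_whiskerRight] at h1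
  rw [whiskerLeft_comp, whiskerLeft_comp, Category.assoc, Category.assoc,
    ← associator_naturality_middle_assoc, reassoc_of% h1,
    associator_inv_naturality_right_assoc, whisker_exchange, reassoc_of% D.compat s,
    (V s).naturality_id, whisker_exchange_assoc]
  simp

lemma naturality_comp {a b c : B} (f : a ⟶ b) (g : b ⟶ c) :
    (D.naturality (f ≫ g)).hom ≫ D.app a ◁ (G.mapComp f g).hom =
      (P.mapComp f g).hom ▷ D.app c ≫ (α_ _ _ _).hom ≫ P.map f ◁ (D.naturality g).hom ≫
        (α_ _ _ _).inv ≫ (D.naturality f).hom ▷ G.map g ≫ (α_ _ _ _).hom := by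
  refine D.ext fun s => ?_
  have h1 := congr($((U s).naturality_comp f g) ▷ D.app c)
  simp only [comp_whiskerRight] at h1
  rw [whiskerLeft_comp, whiskerLeft_comp, Category.assoc, Category.assoc,
    ← associator_naturality_middle_assoc, reassoc_of% h1,
    associator_inv_naturality_right_assoc, whisker_exchange, reassoc_of% D.compat s,
    (V s).naturality_comp, whisker_exchange_assoc]
  have h2 := congr((X s).map f ◁ $(D.compat s g))
  have h3 := congr($(D.compat s f) ▷ G.map g)
  simp only [whiskerLeft_comp] at h2
  simp only [comp_whiskerRight] at h3
  -- After `compat` at `f` and at `g`, the two sides differ by the order of these independent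
  -- 2-cells.
  have h4 := whisker_exchange ((U s).naturality f).hom (D.naturality g).hom
  simp only [comp_whiskerLeft, whiskerRight_comp, Category.assoc] at h4
  rw [associator_naturality_right_assoc, ← reassoc_of% h2, associator_inv_naturality_middle_assoc,
    ← reassoc_of% h3]
  have h5 := congr((α_ _ _ _).hom ≫ $h4 ≫ (α_ _ _ _).hom)
  simp only [Category.assoc, Iso.hom_inv_id_assoc, Iso.inv_hom_id, Category.comp_id] at h5
  simp [← reassoc_of% h5]

/-- The strong transformation defined by the data. -/
def toStrongTrans : P ⟶ G where
  app := D.app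
  naturality := D.naturality
  naturality_naturality := D.naturality_naturality
  naturality_id := D.naturality_id
  naturality_comp := D.naturality_comp

/-- The strong transformation defined by the data factors the given ones. -/
def compIso (s : S) : U s ≫ D.toStrongTrans ≅ V s :=
  Pseudofunctor.StrongTrans.isoMk (D.iso s) (fun {a b} f => by
    change _ = ((α_ _ _ _).inv ≫ ((U s).naturality f).hom ▷ D.app b ≫ (α_ _ _ _).hom ≫
      (U s).app a ◁ (D.naturality f).hom ≫ (α_ _ _ _).inv) ≫ (D.iso s a).hom ▷ G.map f
    simp only [Category.assoc]
    exact (D.compat s f).symm)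

end StrongTransData

/-- A family of 2-cells between the components of two strong transformations is a modification if
it becomes one after composition with a jointly faithful family of strong transformations. -/
lemma exists_modification {S : Type u₃} {X : S → B ⥤ᵖ C} {P G : B ⥤ᵖ C} (U : ∀ s, X s ⟶ P)
    (hU : ∀ b, JointlyFaithful fun s => (U s).app b) {σ τ : P ⟶ G} (α : ∀ b, σ.app b ⟶ τ.app b)
    (Φ : ∀ s, U s ≫ σ ⟶ U s ≫ τ) (h : ∀ s b, (Φ s).as.app b = (U s).app b ◁ α b) :
    ∃ Ψ : σ ⟶ τ, ∀ b, Ψ.as.app b = α b := by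
  refine ⟨⟨{ app := α, naturality := fun {a b} f => ?_ }⟩, fun b => rfl⟩
  refine hU a _ _ fun s => ?_
  -- This is the modification axiom of `Φ s` with its components replaced by means of `h`; the
  -- constraint of `U s` is invertible and cancels.
  have h1 : (X s).map f ◁ (U s).app b ◁ α b ≫
      (α_ ((X s).map f) ((U s).app b) (τ.app b)).inv ≫ ((U s).naturality f).hom ▷ τ.app b ≫
        (α_ _ _ _).hom ≫ (U s).app a ◁ (τ.naturality f).hom ≫ (α_ _ _ _).inv =
      ((α_ ((X s).map f) ((U s).app b) (σ.app b)).inv ≫ ((U s).naturality f).hom ▷ σ.app b ≫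
        (α_ _ _ _).hom ≫ (U s).app a ◁ (σ.naturality f).hom ≫ (α_ _ _ _).inv) ≫
        ((U s).app a ◁ α a) ▷ G.map f := by
    have h2 := (Φ s).as.naturality f
    rw [h, h] at h2
    exact h2
  rw [associator_inv_naturality_right_assoc, whisker_exchange_assoc] at h1
  simp only [comp_whiskerLeft, whisker_assoc, Category.assoc, Iso.inv_hom_id_assoc,
    cancel_epi] at h1
  simpa only [whiskerLeft_comp, ← Category.assoc, cancel_mono] using h1


end JointlyFaithful

end BicatColim

namespace BicatColim

/-! ### Diagrams of pseudofunctors, evaluated at an object -/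

section Evaluation

variable {J : Type u₁} [Bicategory.{w₁, v₁} J] {B : Type u₂} [Bicategory.{w₂, v₂} B]
  {C : Type u₃} [Bicategory.{w₃, v₃} C]

/-- The components of an invertible modification. -/
def modificationApp {F G : B ⥤ᵖ C} {σ τ : F ⟶ G} (e : σ ≅ τ) (b : B) : σ.app b ≅ τ.app b where
  hom := e.hom.as.app b
  inv := e.inv.as.app b
  hom_inv_id := congr(($e.hom_inv_id).as.app b)
  inv_hom_id := congr(($e.inv_hom_id).as.app b)

variable (X : J ⥤ᵖ (B ⥤ᵖ C))

/-- The evaluation at `b` of a diagram of pseudofunctors. -/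
abbrev evalDiagram (b : B) : J ⥤ᵖ C where
  obj j := (X.obj j).obj b
  map g := (X.map g).app b
  map₂ θ := (X.map₂ θ).as.app b
  map₂_id g := congr(($(X.map₂_id g)).as.app b)
  map₂_comp θ θ' := congr(($(X.map₂_comp θ θ')).as.app b)
  mapId j := modificationApp (X.mapId j) b
  mapComp g h := modificationApp (X.mapComp g h) b
  map₂_whisker_left g _ _ θ := congr(($(X.map₂_whisker_left g θ)).as.app b)
  map₂_whisker_right θ h := congr(($(X.map₂_whisker_right θ h)).as.app b)
  map₂_associator f g h := congr(($(X.map₂_associator f g h)).as.app b)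
  map₂_left_unitor f := congr(($(X.map₂_left_unitor f)).as.app b)
  map₂_right_unitor f := congr(($(X.map₂_right_unitor f)).as.app b)

variable {X} {b b' b'' : B}

/-- Evaluation exchanges the roles of `J` and `B`: read as a constraint in `j`, the constraint of
`X.map g` at `f` is traversed backwards. -/
lemma modification_naturality_inv {F G : B ⥤ᵖ C} {σ τ : F ⟶ G} (Γ : σ ⟶ τ) (f : b ⟶ b') :
    Γ.as.app b ▷ G.map f ≫ (τ.naturality f).inv = (σ.naturality f).inv ≫ F.map f ◁ Γ.as.app b' := by
  rw [Iso.comp_inv_eq, Category.assoc, Γ.as.naturality, Iso.inv_hom_id_assoc]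

variable (X)

/-- The strong transformation between evaluations of a diagram of pseudofunctors induced by a
1-cell. -/
def evalDiagramMap (f : b ⟶ b') : evalDiagram X b ⟶ evalDiagram X b' where
  app j := (X.obj j).map f
  naturality g := ((X.map g).naturality f).symm
  naturality_naturality θ := modification_naturality_inv (X.map₂ θ) f
  naturality_id j := by
    have h := modification_naturality_inv (X.mapId j).hom f
    exact h.symm
  naturality_comp {j j' j''} g h := by
    have hm := modification_naturality_inv (X.mapComp g h).hom f
    change ((X.map (g ≫ h)).naturality f).inv ≫ (X.obj j).map f ◁ (X.mapComp g h).hom.as.app b' =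
      (X.mapComp g h).hom.as.app b ▷ (X.obj j'').map f ≫
        (α_ ((X.map g).app b) ((X.map h).app b) ((X.obj j'').map f)).hom ≫
        (X.map g).app b ◁ ((X.map h).naturality f).inv ≫
          (α_ ((X.map g).app b) ((X.obj j').map f) ((X.map h).app b')).inv ≫
          ((X.map g).naturality f).inv ▷ (X.map h).app b' ≫
            (α_ ((X.obj j).map f) ((X.map g).app b') ((X.map h).app b')).hom
    refine hm.symm.trans (congr(_ ≫ $(?_)))
    change ((((α_ ((X.map g).app b) ((X.map h).app b) ((X.obj j'').map f)).hom ≫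
              (X.map g).app b ◁ ((X.map h).naturality f).inv) ≫
            (α_ ((X.map g).app b) ((X.obj j').map f) ((X.map h).app b')).inv) ≫
          ((X.map g).naturality f).inv ▷ (X.map h).app b') ≫
        (α_ ((X.obj j).map f) ((X.map g).app b') ((X.map h).app b')).hom = _
    simp only [Category.assoc]
    rfl

/-- The modification between evaluations of a diagram of pseudofunctors induced by a 2-cell. -/
def evalDiagramMap₂ {f f' : b ⟶ b'} (η : f ⟶ f') : evalDiagramMap X f ⟶ evalDiagramMap X f' where
  as :=
    { app j := (X.obj j).map₂ η
      naturality {j j'} g := by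
        change (X.map g).app b ◁ (X.obj j').map₂ η ≫ ((X.map g).naturality f').inv =
          ((X.map g).naturality f).inv ≫ (X.obj j).map₂ η ▷ (X.map g).app b'
        rw [Iso.comp_inv_eq, Category.assoc, (X.map g).naturality_naturality,
          Iso.inv_hom_id_assoc] }

/-- Compatibility of `evalDiagramMap` with composition of 1-cells. -/
def evalDiagramMapComp (f : b ⟶ b') (g : b' ⟶ b'') :
    evalDiagramMap X (f ≫ g) ≅ evalDiagramMap X f ≫ evalDiagramMap X g :=
  Pseudofunctor.StrongTrans.isoMk (fun j => (X.obj j).mapComp f g) (fun {j j'} h => by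
    change (X.map h).app b ◁ ((X.obj j').mapComp f g).hom ≫ (α_ _ _ _).inv ≫
        ((X.map h).naturality f).inv ▷ (X.obj j').map g ≫ (α_ _ _ _).hom ≫
          (X.obj j).map f ◁ ((X.map h).naturality g).inv ≫ (α_ _ _ _).inv =
      ((X.map h).naturality (f ≫ g)).inv ≫ ((X.obj j).mapComp f g).hom ▷ (X.map h).app b''
    simp [Pseudofunctor.StrongTrans.naturality_comp_inv])

variable {X} {W : Jᵒᵖ ⥤ᵖ Cat.{w, v}} {G : B ⥤ᵖ C}

namespace WCocone

/-- The evaluation at `b` of a weighted cocone under a diagram of pseudofunctors. -/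
def eval (c : WCocone W X G) (b : B) : WCocone W (evalDiagram X b) (G.obj b) where
  obj j w := (c.obj j w).app b
  map φ := (c.map φ).as.app b
  map_id w := congr(($(c.map_id w)).as.app b)
  map_comp φ ψ := congr(($(c.map_comp φ ψ)).as.app b)
  glue g w := modificationApp (c.glue g w) b
  glue_naturality g _ _ φ := congr(($(c.glue_naturality g φ)).as.app b)
  glue_map₂ θ w := congr(($(c.glue_map₂ θ w)).as.app b)
  glue_id j w := congr(($(c.glue_id j w)).as.app b)
  glue_comp g h w := congr(($(c.glue_comp g h w)).as.app b)

/-- The evaluation at `b` of a morphism of weighted cocones under a diagram of pseudofunctors. -/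
def evalMap {c d : WCocone W X G} (Γ : c ⟶ d) (b : B) : c.eval b ⟶ d.eval b where
  app j w := (Γ.app j w).as.app b
  naturality φ := congr(($(Γ.naturality φ)).as.app b)
  glue g w := congr(($(Γ.glue g w)).as.app b)

/-- The naturality in `b` of the evaluation at `b`. -/
def evalNaturality (c : WCocone W X G) (f : b ⟶ b') :
    (c.eval b').precomp (evalDiagramMap X f) ≅ (c.eval b).postcomp (G.map f) :=
  isoMk (fun j w => (c.obj j w).naturality f) (fun φ => (c.map φ).as.naturality f)
    (fun {j j'} g w => by
      change ((c.obj j _).naturality f).hom ≫ (c.glue g w).hom.as.app b ▷ G.map f ≫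
          (α_ ((X.map g).app b) ((c.obj j' w).app b) (G.map f)).hom =
        ((X.obj j).map f ◁ (c.glue g w).hom.as.app b' ≫
          (α_ ((X.obj j).map f) ((X.map g).app b') ((c.obj j' w).app b')).inv ≫
          ((X.map g).naturality f).hom ▷ (c.obj j' w).app b' ≫
            (α_ ((X.map g).app b) ((X.obj j').map f) ((c.obj j' w).app b')).hom) ≫
          (X.map g).app b ◁ ((c.obj j' w).naturality f).hom
      have h := (c.glue g w).hom.as.naturality f
      -- Pure rearrangement: the modification axiom of the gluing has the last associator on the
      -- other side.
      have key {D : Type _} [Category D] {p q r s t x y z : D} {m₁ : p ⟶ q} {m₂ : q ⟶ r}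
          {n₁ : p ⟶ s} {n₂ : s ⟶ t} {n₃ : t ⟶ x} {n₄ : x ⟶ y} {n₅ : y ⟶ z} (β : r ≅ z)
          (h : n₁ ≫ n₂ ≫ n₃ ≫ n₄ ≫ n₅ ≫ β.inv = m₁ ≫ m₂) :
          m₁ ≫ m₂ ≫ β.hom = (n₁ ≫ n₂ ≫ n₃ ≫ n₄) ≫ n₅ := by
        simp [← reassoc_of% h]
      exact key (α_ ((X.map g).app b) ((c.obj j' w).app b) (G.map f)) h)

end WCocone

end Evaluation

end BicatColim

namespace BicatColim

/-! ### Pointwise weighted colimits of pseudofunctors -/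

section Pointwise

variable {J : Type u₁} [Bicategory.{w₁, v₁} J] {B : Type u₂} [Bicategory.{w₂, v₂} B]
  {C : Type u₃} [Bicategory.{w₃, v₃} C] {X : J ⥤ᵖ (B ⥤ᵖ C)} {W : Jᵒᵖ ⥤ᵖ Cat.{w, v}}

namespace WCocone

/-- Composition of a weighted cocone with the transformation of evaluations induced by an identity
1-cell. -/
def evalPrecompId {b : B} {i : C} (c : WCocone W (evalDiagram X b) i) :
    c.precomp (evalDiagramMap X (𝟙 b)) ≅ c.postcomp (𝟙 i) :=
  isoMk (fun j w => whiskerRightIso ((X.obj j).mapId b) (c.obj j w) ≪≫ λ_ (c.obj j w) ≪≫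
      (ρ_ (c.obj j w)).symm)
    (fun {j w w'} φ => by
      change (X.obj j).map (𝟙 b) ◁ c.map φ ≫ ((X.obj j).mapId b).hom ▷ c.obj j w' ≫
          (λ_ (c.obj j w')).hom ≫ (ρ_ (c.obj j w')).inv =
        (((X.obj j).mapId b).hom ▷ c.obj j w ≫ (λ_ (c.obj j w)).hom ≫ (ρ_ (c.obj j w)).inv) ≫
          c.map φ ▷ 𝟙 i
      rw [whisker_exchange_assoc]
      simp)
    (fun {j j'} g w => by
      change (((X.obj j).mapId b).hom ▷ c.obj j _ ≫ (λ_ (c.obj j _)).hom ≫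
          (ρ_ (c.obj j _)).inv) ≫ (c.glue g w).hom ▷ 𝟙 i ≫
            (α_ ((X.map g).app b) (c.obj j' w) (𝟙 i)).hom =
        ((X.obj j).map (𝟙 b) ◁ (c.glue g w).hom ≫
          (α_ ((X.obj j).map (𝟙 b)) ((X.map g).app b) (c.obj j' w)).inv ≫
            ((X.map g).naturality (𝟙 b)).hom ▷ c.obj j' w ≫
              (α_ ((X.map g).app b) ((X.obj j').map (𝟙 b)) (c.obj j' w)).hom) ≫
          (X.map g).app b ◁ (((X.obj j').mapId b).hom ▷ c.obj j' w ≫ (λ_ (c.obj j' w)).hom ≫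
            (ρ_ (c.obj j' w)).inv)
      have h := congr($((X.map g).naturality_id b) ▷ c.obj j' w)
      simp only [comp_whiskerRight] at h
      simp only [whiskerLeft_comp, Category.assoc]
      rw [← associator_naturality_middle_assoc, reassoc_of% h,
        ← associator_inv_naturality_left_assoc, whisker_exchange_assoc]
      simp)

variable {p : B → C} (u : ∀ b, WCocone W (evalDiagram X b) (p b))
  [∀ b i, ((u b).postcomposing i).IsEquivalence]

/-- The 1-cell out of the vertex of a colimiting cocone induced by a cocone. -/
noncomputable def desc {F : J ⥤ᵖ C} {q i : C} (c : WCocone W F q)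
    [(c.postcomposing i).IsEquivalence] (d : WCocone W F i) : q ⟶ i :=
  (c.postcomposing i).objPreimage d

/-- The 1-cell induced by a cocone factors the cocone. -/
noncomputable def descIso {F : J ⥤ᵖ C} {q i : C} (c : WCocone W F q)
    [(c.postcomposing i).IsEquivalence] (d : WCocone W F i) : c.postcomp (c.desc d) ≅ d :=
  (c.postcomposing i).objObjPreimageIso d

/-- The 2-cell out of the vertex of a colimiting cocone induced by a morphism of cocones. -/
noncomputable def desc₂ {F : J ⥤ᵖ C} {q i : C} (c : WCocone W F q)
    [(c.postcomposing i).Full] {m m' : q ⟶ i} (f : c.postcomp m ⟶ c.postcomp m') :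
    m ⟶ m' :=
  (c.postcomposing i).preimage f

lemma whiskerLeft_desc₂ {F : J ⥤ᵖ C} {q i : C} (c : WCocone W F q)
    [(c.postcomposing i).Full] {m m' : q ⟶ i} (f : c.postcomp m ⟶ c.postcomp m')
    (j : J) (w : W.obj (op j)) : c.obj j w ◁ c.desc₂ f = f.app j w :=
  congr(($((c.postcomposing i).map_preimage f)).app j w)

/-- The invertible 2-cell out of the vertex of a colimiting cocone induced by an isomorphism of
cocones. -/
noncomputable def desc₂Iso {F : J ⥤ᵖ C} {q i : C} (c : WCocone W F q)
    [(c.postcomposing i).IsEquivalence] {m m' : q ⟶ i} (f : c.postcomp m ≅ c.postcomp m') :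
    m ≅ m' :=
  (c.postcomposing i).preimageIso f

lemma whiskerLeft_desc₂Iso_hom {F : J ⥤ᵖ C} {q i : C} (c : WCocone W F q)
    [(c.postcomposing i).IsEquivalence] {m m' : q ⟶ i} (f : c.postcomp m ≅ c.postcomp m')
    (j : J) (w : W.obj (op j)) : c.obj j w ◁ (c.desc₂Iso f).hom = f.hom.app j w :=
  congr(($((c.postcomposing i).map_preimage f.hom)).app j w)

/-- The action on 1-cells of the pointwise colimit. -/
noncomputable def pointwiseMap {a b : B} (f : a ⟶ b) : p a ⟶ p b :=
  (u a).desc ((u b).precomp (evalDiagramMap X f))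

/-- The naturality of the colimiting cocones of the pointwise colimit. -/
noncomputable def pointwiseMapIso {a b : B} (f : a ⟶ b) :
    (u a).postcomp (pointwiseMap u f) ≅ (u b).precomp (evalDiagramMap X f) :=
  (u a).descIso _

/-- This is the faithful half of the universal property; it makes `PseudofunctorData` and
`StrongTransData` applicable to coprojections. -/
lemma jointlyFaithful {F : J ⥤ᵖ C} {q : C} (c : WCocone W F q)
    [∀ i, (c.postcomposing i).IsEquivalence] :
    JointlyFaithful fun s : (Σ j, W.obj (op j)) => c.obj s.1 s.2 := fun i _ _ _ _ h =>
  (c.postcomposing i).map_injective (hom_ext fun j w => h ⟨j, w⟩)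

/-- The data of the pointwise colimit of a diagram of pseudofunctors. -/
noncomputable def pointwiseData :
    PseudofunctorData fun s : (Σ j, W.obj (op j)) => X.obj s.1 where
  obj := p
  map := pointwiseMap u
  map₂ {a b f g} η := (u a).desc₂
    ((pointwiseMapIso u f).hom ≫ (u b).precompMap (evalDiagramMap₂ X η) ≫
      (pointwiseMapIso u g).inv)
  mapId a := (u a).desc₂Iso (pointwiseMapIso u (𝟙 a) ≪≫ (u a).evalPrecompId)
  -- Both 1-cells represent the cocone at `c` pulled back along `f ≫ g`: the pullback is split in
  -- two, and each stage is replaced by composition with a `pointwiseMap`.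
  mapComp {a b c} f g := (u a).desc₂Iso
    (pointwiseMapIso u (f ≫ g) ≪≫ (u c).precompMapIso (evalDiagramMapComp X f g) ≪≫
      precompComp _ _ _ ≪≫ (precompFunctor _).mapIso (pointwiseMapIso u g).symm ≪≫
      (precompPostcomp _ _ _).symm ≪≫ (postcompFunctor _).mapIso (pointwiseMapIso u f).symm ≪≫
      postcompAssoc _ _ _)
  app s b := (u b).obj s.1 s.2
  jointlyFaithful b := (u b).jointlyFaithful
  naturality s {a b} f := (appIso (pointwiseMapIso u f) s.1 s.2).symm
  naturality_naturality s {a b f g} η := by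
    -- The 2-cell was defined by its whiskerings with the coprojections, beginning with the inverse
    -- of the constraint; this pair cancels.
    rw [whiskerLeft_desc₂]
    exact (Iso.inv_hom_id_assoc (appIso (pointwiseMapIso u f) s.1 s.2) _).symm
  naturality_id s a := by
    rw [whiskerLeft_desc₂Iso_hom]
    exact (Iso.inv_hom_id_assoc (appIso (pointwiseMapIso u (𝟙 a)) s.1 s.2) _)
  naturality_comp s {a b c} f g := by
    rw [whiskerLeft_desc₂Iso_hom]
    exact (Iso.inv_hom_id_assoc (appIso (pointwiseMapIso u (f ≫ g)) s.1 s.2) _)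

end WCocone

end Pointwise

end BicatColim

/-! ### Universality of the pointwise colimit. -/

namespace BicatColim

section Pointwise

variable {J : Type u₁} [Bicategory.{w₁, v₁} J] {B : Type u₂} [Bicategory.{w₂, v₂} B]
  {C : Type u₃} [Bicategory.{w₃, v₃} C] {X : J ⥤ᵖ (B ⥤ᵖ C)} {W : Jᵒᵖ ⥤ᵖ Cat.{w, v}}

namespace WCocone

/-- The constraint of the induced transformation is defined by conjugating `t` with `e`, `i` and
`i'`; undoing the conjugation is the compatibility axiom of `StrongTransData`. -/
lemma compat_of_eq {x x' y y' z z' : C} {u : x ⟶ y} {m : y ⟶ y'} {ξ : x ⟶ x'} {u' : x' ⟶ y'}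
    {σ : y ⟶ z} {σ' : y' ⟶ z'} {v : x ⟶ z} {v' : x' ⟶ z'} {g : z ⟶ z'} (e : u ≫ m ≅ ξ ≫ u')
    (i' : u' ≫ σ' ≅ v') (i : u ≫ σ ≅ v) {t : ξ ≫ v' ⟶ v ≫ g} {n : u ≫ m ≫ σ' ⟶ u ≫ σ ≫ g}
    (h : n = (α_ u m σ').inv ≫ e.hom ▷ σ' ≫ (α_ ξ u' σ').hom ≫ ξ ◁ i'.hom ≫ t ≫ i.inv ▷ g ≫
      (α_ u σ g).hom) :
    (α_ ξ u' σ').inv ≫ e.inv ▷ σ' ≫ (α_ u m σ').hom ≫ n ≫ (α_ u σ g).inv ≫ i.hom ▷ g =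
      ξ ◁ i'.hom ≫ t := by
  simp [h]

variable {p : B → C} (u : ∀ b, WCocone W (evalDiagram X b) (p b))
  [∀ b i, ((u b).postcomposing i).IsEquivalence]

/-- The pointwise colimit of a diagram of pseudofunctors. -/
noncomputable abbrev pointwise : B ⥤ᵖ C :=
  (pointwiseData u).toPseudofunctor

/-- The coprojections of the pointwise colimit. -/
noncomputable abbrev pointwiseι (j : J) (w : W.obj (op j)) : X.obj j ⟶ pointwise u :=
  (pointwiseData u).strongTrans ⟨j, w⟩

/-- The colimit cocone of the pointwise colimit. -/
noncomputable def pointwiseCocone : WCocone W X (pointwise u) where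
  obj := pointwiseι u
  map {j w w'} φ := { as :=
    { app b := (u b).map φ
      -- The modification axiom at `f` is the naturality in `w` of the cocone isomorphism that
      -- defines the constraint at `f`.
      naturality {a b} f := (pointwiseMapIso u f).inv.naturality φ } }
  map_id w := by ext b; exact (u b).map_id w
  map_comp φ ψ := by ext b; exact (u b).map_comp φ ψ
  glue {j j'} g w := Pseudofunctor.StrongTrans.isoMk (fun b => (u b).glue g w) (fun {a b} f => by
    have key {D : Type _} [Category D] {p q r s t x y z : D} {m₁ : p ⟶ q} {m₂ : q ⟶ r}
        {n₁ : p ⟶ s} {n₂ : s ⟶ t} {n₃ : t ⟶ x} {n₄ : x ⟶ y} {n₅ : y ⟶ z} (β : r ≅ z)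
        (h : m₁ ≫ m₂ ≫ β.hom = (n₁ ≫ n₂ ≫ n₃ ≫ n₄) ≫ n₅) :
        n₁ ≫ n₂ ≫ n₃ ≫ n₄ ≫ n₅ ≫ β.inv = m₁ ≫ m₂ := by
      rw [← cancel_mono β.hom]
      simp [h]
    exact key (α_ ((X.map g).app a) ((u a).obj j' w) (pointwiseMap u f))
      ((pointwiseMapIso u f).inv.glue g w))
  glue_naturality g _ _ φ := by ext b; exact (u b).glue_naturality g φ
  glue_map₂ θ w := by ext b; exact (u b).glue_map₂ θ w
  glue_id j w := by ext b; exact (u b).glue_id j w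
  glue_comp g h w := by ext b; exact (u b).glue_comp g h w

/-- 1-cells and 2-cells are induced separately at each `b`; their compatibility in `b` holds after
whiskering with the coprojections, hence holds. -/
lemma isColim_pointwiseCocone : (pointwiseCocone u).IsColim fun _ => True := fun G _ =>
  { faithful := ⟨fun {σ τ Φ Ψ} h => by
      ext b
      exact (u b).jointlyFaithful _ _ fun s => congr((($h).app s.1 s.2).as.app b)⟩
    full := ⟨fun {σ τ} Γ => by
      let Γ' (b : B) : (u b).postcomp (σ.app b) ⟶ (u b).postcomp (τ.app b) := evalMap Γ b
      obtain ⟨Ψ, hΨ⟩ := exists_modification (fun s : (Σ j, W.obj (op j)) => pointwiseι u s.1 s.2)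
        (fun b => (u b).jointlyFaithful) (fun b => (u b).desc₂ (Γ' b)) (fun s => Γ.app s.1 s.2)
        (fun s b => ((u b).whiskerLeft_desc₂ (Γ' b) s.1 s.2).symm)
      refine ⟨Ψ, hom_ext fun j w => ?_⟩
      ext b
      change (u b).obj j w ◁ Ψ.as.app b = _
      rw [hΨ]
      exact (u b).whiskerLeft_desc₂ (Γ' b) j w⟩
    essSurj := ⟨fun c => by
      let D : StrongTransData (fun s : (Σ j, W.obj (op j)) => pointwiseι u s.1 s.2)
        (fun s => c.obj s.1 s.2) :=
        { jointlyFaithful b := (u b).jointlyFaithful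
          app b := (u b).desc (c.eval b)
          iso s b := appIso ((u b).descIso (c.eval b)) s.1 s.2
          -- Both 1-cells out of the colimit at `a` represent the cocone of `c` at `b` pulled back
          -- along `f`, which `evalNaturality` identifies with the cocone at `a` followed by `G.map
          -- f`.
          naturality {a b} f := (u a).desc₂Iso ((postcompAssoc _ _ _).symm ≪≫
            (postcompFunctor _).mapIso (pointwiseMapIso u f) ≪≫ precompPostcomp _ _ _ ≪≫
            (precompFunctor _).mapIso ((u b).descIso (c.eval b)) ≪≫ c.evalNaturality f ≪≫
            (postcompFunctor (G.map f)).mapIso ((u a).descIso (c.eval a)).symm ≪≫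
            postcompAssoc _ _ _)
          compat s {a b} f := by
            exact compat_of_eq (appIso (pointwiseMapIso u f) s.1 s.2)
              (appIso ((u b).descIso (c.eval b)) s.1 s.2)
              (appIso ((u a).descIso (c.eval a)) s.1 s.2)
              ((u a).whiskerLeft_desc₂Iso_hom _ s.1 s.2) }
      exact ⟨D.toStrongTrans, ⟨isoMk (fun j w => D.compIso ⟨j, w⟩)
        (fun {j w w'} φ => by ext b; exact ((u b).descIso (c.eval b)).hom.naturality φ)
        (fun {j j'} g w => by ext b; exact ((u b).descIso (c.eval b)).hom.glue g w)⟩⟩⟩ }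

end WCocone

end Pointwise

end BicatColim

namespace BicatColim

/-! ### Weighted colimits of linear pseudofunctors -/

section Linear

variable {k : Type u} [CommRing k]

/-- Whiskering and composition in `C` are linear, so after whiskering with the jointly faithful
family the identities follow from the linearity of the `X s`. -/
lemma PseudofunctorData.isLinear {B : Type u₁} [Bicategory.{w₁, v₁} B]
    [∀ a b : B, Preadditive (a ⟶ b)] [∀ a b : B, Linear k (a ⟶ b)]
    {C : Type u₂} [Bicategory.{w₂, v₂} C]
    [∀ a b : C, Preadditive (a ⟶ b)] [∀ a b : C, Linear k (a ⟶ b)] [LinearBicategory k C]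
    {S : Type u₃} {X : S → B ⥤ᵖ C} (D : PseudofunctorData X)
    (hX : ∀ s, IsLinearPseudofunctor k (X s)) : IsLinearPseudofunctor k D.toPseudofunctor where
  map₂_add η θ := show D.map₂ (η + θ) = D.map₂ η + D.map₂ θ from D.ext fun s => by
    rw [← D.naturality_naturality, (hX s).map₂_add, LinearBicategory.add_whiskerRight k,
      LinearBicategory.whiskerLeft_add k, Preadditive.add_comp, Preadditive.comp_add,
      D.naturality_naturality, D.naturality_naturality]
  map₂_smul r η := show D.map₂ (r • η) = r • D.map₂ η from D.ext fun s => by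
    rw [← D.naturality_naturality, (hX s).map₂_smul, LinearBicategory.smul_whiskerRight,
      LinearBicategory.whiskerLeft_smul, Linear.smul_comp, Linear.comp_smul,
      D.naturality_naturality]

lemma HasWeightedColimits.linearPseudofunctorBicategory {B : Type u} [Bicategory.{u, u} B]
    [∀ a b : B, Preadditive (a ⟶ b)] [∀ a b : B, Linear k (a ⟶ b)]
    {C : Type v} [Bicategory.{u, u} C]
    [∀ a b : C, Preadditive (a ⟶ b)] [∀ a b : C, Linear k (a ⟶ b)] [LinearBicategory k C]
    (hC : HasWeightedColimits.{u} C) :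
    HasWeightedColimits.{u} (LinearPseudofunctorBicategory k B C) := fun J _ W F => by
  choose p c hc using fun b : B => hC J W (evalDiagram (FullSubbicategory.val F) b)
  have := fun b i => hc b i trivial
  -- The pointwise colimit of linear pseudofunctors is linear, so the colimit among all
  -- pseudofunctors already lies in the full sub-bicategory.
  exact ⟨⟨WCocone.pointwise c, PseudofunctorData.isLinear _ fun s => (F.obj s.1).2⟩, _,
    FullSubbicategory.isColim_liftWCocone (X := ⟨WCocone.pointwise c, _⟩)
      fun i _ => WCocone.isColim_pointwiseCocone c i trivial⟩

end Linear

end BicatColim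

theorem mainTheorem8 (k : Type u) [CommRing k] :
    (BicatColim.BicategoricallyCocomplete.{u} (BicatColim.AdditiveLinCat k) ∧
      BicatColim.BicategoricallyCocomplete.{u} (BicatColim.IdempotentSplitLinCat k) ∧
      BicatColim.BicategoricallyCocomplete.{u} (BicatColim.AdditiveIdempotentSplitLinCat k)) ∧
    ∀ (B : Type u) [Bicategory.{u, u} B]
      [∀ a b : B, Preadditive (a ⟶ b)] [∀ a b : B, Linear k (a ⟶ b)]
      [BicatColim.LinearBicategory k B],
      BicatColim.BicategoricallyCocomplete.{u}
        (BicatColim.LinearPseudofunctorBicategory k B (BicatColim.AdditiveLinCat k)) ∧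
      BicatColim.BicategoricallyCocomplete.{u}
        (BicatColim.LinearPseudofunctorBicategory k B (BicatColim.IdempotentSplitLinCat k)) ∧
      BicatColim.BicategoricallyCocomplete.{u}
        (BicatColim.LinearPseudofunctorBicategory k B
          (BicatColim.AdditiveIdempotentSplitLinCat k)) := by
  have h₁ := BicatColim.LinCat.hasWeightedColimits_additive (k := k)
  have h₂ := BicatColim.LinCat.hasWeightedColimits_idempotentSplit (k := k)
  have h₃ := BicatColim.LinCat.hasWeightedColimits_additiveIdempotentSplit (k := k)
  exact ⟨⟨h₁.bicategoricallyCocomplete, h₂.bicategoricallyCocomplete,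
    h₃.bicategoricallyCocomplete⟩, fun B _ _ _ _ =>
    ⟨h₁.linearPseudofunctorBicategory.bicategoricallyCocomplete,
      h₂.linearPseudofunctorBicategory.bicategoricallyCocomplete,
      h₃.linearPseudofunctorBicategory.bicategoricallyCocomplete⟩⟩
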